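/- **Setting.** A base station (BS) with $B$ antennas serves $N$ cellular users (CUs) in the presence of $K$ device-to-device (D2D) pairs. For CU $n$ let $q_{s,n},q_{p,n}\ge 0$ be the data and pilot powers and $u^{(c)}_n\ge0$ the large-scale fading coefficient to the BS; for D2D transmitter $i$ let $p_{s,i},p_{p,i}\ge0$ and $u^{(d)}_i\ge 0$ be the analogous quantities. Let $N_0>0$ be the noise variance, $N<\tau\le N+K$ the pilot length, and $T\ge\tau$ the length of the coherence interval. The fast fading vectors $h^{(c)}_n,h^{(d)}_i\sim\mathcal{CN}(0,I_B)$ and the noise matrix $Z\in\mathbb C^{B\times\tau}$ with i.i.d. $\mathcal{CN}(0,N_0)$ entries are mutually independent. Let $\omega_1,\dots,\omega_\tau\in\mathbb C^\tau$ be orthonormal pilots. CU $n$ uses $\omega_n$; D2D pair $i$ uses a pilot $\lambda_i\in\{\omega_{N+1},\dots,\omega_\tau\}$, and several pairs may use the same one. Let $\mathcal X_k$ be the set of D2D pairs with the same pilot as pair $k$ (including $k$). The BS observes $$Y=\sum_{n=1}^N\sqrt{q_{p,n}u^{(c)}_n}\,h^{(c)}_n\omega_n^H+\sum_{i=1}^K\sqrt{p_{p,i}u^{(d)}_i}\,h^{(d)}_i\lambda_i^H+Z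 ,$$ and $\hat h^{(c)}_n=\mathbb E[h^{(c)}_n\mid Y]$, $\hat h^{(d)}_i=\mathbb E[h^{(d)}_i\mid Y]$ are the MMSE channel estimates. Put $$\delta^{(c)}_n=\frac{q_{p,n}u^{(c)}_n}{q_{p,n}u^{(c)}_n+N_0},\quad \varepsilon^{(c)}_n=1-\delta^{(c)}_n,\qquad \delta^{(d)}_k=\frac{p_{p,k}u^{(d)}_k}{\sum_{i\in\mathcal X_k}p_{p,i}u^{(d)}_i+N_0},\quad \varepsilon^{(d)}_k=1-\delta^{(d)}_k .$$ Let $b_c,b_d\in\mathbb N$ with $b_c\le N-1$, $b_d\le\tau-N$ and $b_c+b_d\le B-1$. To detect CU $n$, the BS cancels any fixed choice of $b_c$ of the other CUs and of the D2D pairs that use one of $b_d$ chosen pilots among $\omega_{N+1},\dots,\omega_\tau$. Let $\mathcal C_n^{(c)}\ni n$ be the set of uncancelled CUs and $\mathcal D^{(c)}$ the set of uncancelled D2D pairs. The partial zero-forcing (PZF) filter $\beta_n$ is the normalized orthogonal projection of $\hat h^{(c)}_n$ onto the orthogonal complement of the span of the channel estimates of the cancelled interferers (and $\beta_n=0$ if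 that projection is zero). The effective SINR of cellular link $n$ is $$\eta_n^{(c)}=\frac{q_{s,n}u^{(c)}_n|\beta_n^H\hat h^{(c)}_n|^2}{\sum_{a\in\mathcal C^{(c)}_n\setminus n}q_{s,a}u^{(c)}_a|\beta_n^H\hat h^{(c)}_a|^2+\sum_{i\in\mathcal D^{(c)}}p_{s,i}u^{(d)}_i|\beta_n^H\hat h^{(d)}_i|^2+\alpha^{(c)}\|\beta_n\|_2^2},$$ (read as $0$ where $\beta_n=0$), where $$\alpha^{(c)}=\sum_{a=1}^N q_{s,a}u^{(c)}_a\varepsilon^{(c)}_a+\sum_{i=1}^K p_{s,i}u^{(d)}_i\varepsilon^{(d)}_i+N_0 .$$ The instantaneous rate is $R_n^{(c)}=(1-\tau/T)\log_2(1+\eta_n^{(c)})$, and the ergodic achievable rate is $\mathbb E[R_n^{(c)}]$. **Theorem.** For every CU $n$, the rate $R_n^{(c)}$ is integrable and $$\mathbb E\big[R_n^{(c)}\big]\;\ge\;\Big(1-\frac{\tau}{T}\Big)\log_2\!\big(1+\eta_n^{(c,lb)}\big),\qquad \eta_n^{(c,lb)}=\frac{q_{s,n}\,\phi_n^{(c)}}{\sum_{a=1}^N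 q_{s,a}\,\varphi_{an}^{(c)}+\sigma^{(c)}},$$ where $$\phi_n^{(c)}=(B-b_c-b_d-1)\,u_n^{(c)}\delta_n^{(c)},\qquad \varphi_{an}^{(c)}=\begin{cases}u_a^{(c)},&a\in\mathcal C_n^{(c)}\setminus n,\\ u_a^{(c)}\varepsilon_a^{(c)},&a=n\text{ or }a\notin\mathcal C_n^{(c)},\end{cases}$$ $$\sigma^{(c)}=\sum_{i=1}^K p_{s,i}\varphi_i^{(d)}+N_0,\qquad \varphi_i^{(d)}=\begin{cases}u_i^{(d)},&i\in\mathcal D^{(c)},\\ u_i^{(d)}\varepsilon_i^{(d)},&i\notin\mathcal D^{(c)}.\end{cases}$$ -/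

import Mathlib

open MeasureTheory ProbabilityTheory

noncomputable section

namespace D2D

/-- The circularly symmetric complex normal law `CN(0, v)` on `ℂ`: independent real and imaginary
parts, each `N(0, v / 2)`. -/
def complexNormal (v : ℝ) : Measure ℂ :=
  ((gaussianReal 0 (v / 2).toNNReal).prod (gaussianReal 0 (v / 2).toNNReal)).map
    (fun p : ℝ × ℝ => (⟨p.1, p.2⟩ : ℂ))

/-- The law `CN(0, v I_B)` on `ℂ^B`: i.i.d. `CN(0, v)` coordinates. -/
def complexNormalVec (B : ℕ) (v : ℝ) : Measure (EuclideanSpace ℂ (Fin B)) :=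
  (Measure.pi (fun _ : Fin B => complexNormal v)).map (WithLp.toLp 2)

/-- Deterministic parameters of the uplink: `N` cellular users (CUs), `K` device-to-device (D2D)
pairs and pilot length `τ`. -/
structure System (N K τ : ℕ) where
  /-- data transmit power of each CU -/
  qs : Fin N → ℝ
  /-- data transmit power of each D2D transmitter -/
  ps : Fin K → ℝ
  /-- pilot transmit power of each CU -/
  qp : Fin N → ℝ
  /-- pilot transmit power of each D2D transmitter -/
  pp : Fin K → ℝ
  /-- large-scale fading coefficient from each CU to the base station (BS) -/
  uc : Fin N → ℝ
  /-- large-scale fading coefficient from each D2D transmitter to the BS -/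
  ud : Fin K → ℝ
  /-- noise variance -/
  N0 : ℝ
  /-- pilot matrix; its columns are the pilots -/
  pilots : Matrix (Fin τ) (Fin τ) ℂ
  /-- index of the pilot (column of `pilots`) used by each D2D pair -/
  pilotOf : Fin K → Fin τ
  qs_nonneg : ∀ n, 0 ≤ qs n
  ps_nonneg : ∀ i, 0 ≤ ps i
  qp_nonneg : ∀ n, 0 ≤ qp n
  pp_nonneg : ∀ i, 0 ≤ pp i
  uc_nonneg : ∀ n, 0 ≤ uc n
  ud_nonneg : ∀ i, 0 ≤ ud i
  N0_pos : 0 < N0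
  tau_gt : N < τ
  tau_le : τ ≤ N + K
  pilots_orthonormal : pilots.conjTranspose * pilots = 1
  /-- The first `N` pilots are reserved for the CUs; D2D pairs share the remaining ones. -/
  pilotOf_ge : ∀ i, N ≤ (pilotOf i : ℕ)

/-- The random quantities of the pilot phase at the BS with `B` antennas: fast fading vectors `hc`
(from the CUs) and `hd` (from the D2D transmitters), and the columns `Z t` of the `B × τ` pilot
noise matrix. -/
structure Channels (Ω : Type*) (N K B τ : ℕ) where
  hc : Fin N → Ω → EuclideanSpace ℂ (Fin B)
  hd : Fin K → Ω → EuclideanSpace ℂ (Fin B)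
  Z : Fin τ → Ω → EuclideanSpace ℂ (Fin B)

namespace Channels

variable {Ω : Type*} {N K B τ : ℕ}

/-- All fading vectors and noise columns as a single family. -/
def all (X : Channels Ω N K B τ) :
    Fin N ⊕ Fin K ⊕ Fin τ → Ω → EuclideanSpace ℂ (Fin B) :=
  Sum.elim X.hc (Sum.elim X.hd X.Z)

/-- The Rayleigh fading model: fading vectors are `CN(0, I_B)`, the noise matrix has i.i.d.
`CN(0, N0)` entries, and all of these are mutually independent. -/
structure IsRayleigh [MeasurableSpace Ω] (X : Channels Ω N K B τ) (N0 : ℝ)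
    (P : Measure Ω) : Prop where
  measurable : ∀ j, Measurable (X.all j)
  indep : iIndepFun X.all P
  law_hc : ∀ n, P.map (X.hc n) = complexNormalVec B 1
  law_hd : ∀ i, P.map (X.hd i) = complexNormalVec B 1
  law_Z : ∀ t, P.map (X.Z t) = complexNormalVec B N0

end Channels

namespace System

variable {Ω : Type*} {N K B τ : ℕ} (s : System N K τ)

/-- The pilot (a vector of length `τ`) allocated to CU `n`: the `n`-th column of the pilot
matrix. -/
def pilotC (n : Fin N) : Fin τ → ℂ := s.pilots.col (Fin.castLE s.tau_gt.le n)

/-- The pilot allocated to D2D pair `i`. -/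
def pilotD (i : Fin K) : Fin τ → ℂ := s.pilots.col (s.pilotOf i)

/-- The set of D2D pairs that use the same pilot as pair `k` (including `k`). -/
def samePilot (k : Fin K) : Finset (Fin K) :=
  Finset.univ.filter (fun i => s.pilotOf i = s.pilotOf k)

/-- The `B × τ` received pilot signal matrix
`Y = ∑ √(qp u) h ω^H + ∑ √(pp u) h λ^H + Z` at the BS. -/
def receivedPilot (X : Channels Ω N K B τ) (ω : Ω) : Matrix (Fin B) (Fin τ) ℂ :=
  (∑ n, ((√(s.qp n * s.uc n) : ℝ) : ℂ) • Matrix.vecMulVec (X.hc n ω).ofLp (star (s.pilotC n)))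
  + (∑ i, ((√(s.pp i * s.ud i) : ℝ) : ℂ) • Matrix.vecMulVec (X.hd i ω).ofLp (star (s.pilotD i)))
  + Matrix.of (fun b t => X.Z t ω b)

/-- The σ-algebra generated by the received pilot matrix (that is, by its entries). -/
@[reducible] def pilotSigma (X : Channels Ω N K B τ) : MeasurableSpace Ω :=
  MeasurableSpace.comap (fun ω => fun (b : Fin B) (t : Fin τ) => s.receivedPilot X ω b t)
    MeasurableSpace.pi

variable [MeasurableSpace Ω]

/-- The MMSE estimate at the BS of the channel of CU `n`: the conditional mean given the received
pilot matrix. -/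
def estC (X : Channels Ω N K B τ) (P : Measure Ω) (n : Fin N) : Ω → EuclideanSpace ℂ (Fin B) :=
  condExp (s.pilotSigma X) P (X.hc n)

/-- The MMSE estimate at the BS of the channel of D2D transmitter `i`. -/
def estD (X : Channels Ω N K B τ) (P : Measure Ω) (i : Fin K) : Ω → EuclideanSpace ℂ (Fin B) :=
  condExp (s.pilotSigma X) P (X.hd i)

/-- `δ_n^{(c)}`, the variance of each entry of the estimate of the channel of CU `n`. -/
def deltaC (n : Fin N) : ℝ := s.qp n * s.uc n / (s.qp n * s.uc n + s.N0)

/-- `ε_n^{(c)} = 1 - δ_n^{(c)}`, the corresponding error variance. -/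
def epsC (n : Fin N) : ℝ := 1 - s.deltaC n

/-- `δ_k^{(d)}`, the variance of each entry of the estimate of the channel of D2D transmitter
`k`. -/
def deltaD (k : Fin K) : ℝ :=
  s.pp k * s.ud k / (∑ i ∈ s.samePilot k, s.pp i * s.ud i + s.N0)

/-- `ε_k^{(d)} = 1 - δ_k^{(d)}`. -/
def epsD (k : Fin K) : ℝ := 1 - s.deltaD k

/-- The set `D^{(c)}` of D2D pairs that are not cancelled when the pilot groups in `G` are. -/
def uncancelledD (G : Finset (Fin τ)) : Finset (Fin K) :=
  Finset.univ.filter (fun i => s.pilotOf i ∉ G)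

/-- The span of the channel estimates of the cancelled interferers: the CUs in `A` and the D2D
pairs using a pilot in `G`. -/
def cancelledSpan (X : Channels Ω N K B τ) (P : Measure Ω) (A : Finset (Fin N))
    (G : Finset (Fin τ)) (ω : Ω) : Submodule ℂ (EuclideanSpace ℂ (Fin B)) :=
  Submodule.span ℂ
    ({v | ∃ a ∈ A, v = s.estC X P a ω} ∪ {v | ∃ i, s.pilotOf i ∈ G ∧ v = s.estD X P i ω})

/-- The partial zero-forcing (PZF) filter for CU `n`: the projection of the estimate of its channel
onto the orthogonal complement of the estimates of the cancelled interferers, normalized. -/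
def pzf (X : Channels Ω N K B τ) (P : Measure Ω) (A : Finset (Fin N)) (G : Finset (Fin τ))
    (n : Fin N) (ω : Ω) : EuclideanSpace ℂ (Fin B) :=
  let v := (s.cancelledSpan X P A G ω)ᗮ.starProjection (s.estC X P n ω)
  ((‖v‖⁻¹ : ℝ) : ℂ) • v

/-- `α^{(c)}`: power of channel estimation error and noise. -/
def alphaC : ℝ :=
  ∑ a, s.qs a * s.uc a * s.epsC a + ∑ i, s.ps i * s.ud i * s.epsD i + s.N0

/-- The desired signal power `S_n^{(c)} = q u |β^H ĥ_n|²`. -/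
def signalPower (X : Channels Ω N K B τ) (P : Measure Ω) (A : Finset (Fin N))
    (G : Finset (Fin τ)) (n : Fin N) (ω : Ω) : ℝ :=
  s.qs n * s.uc n * ‖inner ℂ (s.pzf X P A G n ω) (s.estC X P n ω)‖ ^ 2

/-- The interference power `I_n^{(c→c)}` from the uncancelled CUs other than `n`. -/
def interferenceC (X : Channels Ω N K B τ) (P : Measure Ω) (A : Finset (Fin N))
    (G : Finset (Fin τ)) (n : Fin N) (ω : Ω) : ℝ :=
  ∑ a ∈ Aᶜ \ {n}, s.qs a * s.uc a * ‖inner ℂ (s.pzf X P A G n ω) (s.estC X P a ω)‖ ^ 2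

/-- The interference power `I_n^{(d→c)}` from the uncancelled D2D transmitters. -/
def interferenceD (X : Channels Ω N K B τ) (P : Measure Ω) (A : Finset (Fin N))
    (G : Finset (Fin τ)) (n : Fin N) (ω : Ω) : ℝ :=
  ∑ i ∈ s.uncancelledD G,
    s.ps i * s.ud i * ‖inner ℂ (s.pzf X P A G n ω) (s.estD X P i ω)‖ ^ 2

/-- The effective SINR `η_n^{(c)}` of cellular link `n`. -/
def sinr (X : Channels Ω N K B τ) (P : Measure Ω) (A : Finset (Fin N)) (G : Finset (Fin τ))
    (n : Fin N) (ω : Ω) : ℝ :=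
  s.signalPower X P A G n ω /
    (s.interferenceC X P A G n ω + s.interferenceD X P A G n ω
      + s.alphaC * ‖s.pzf X P A G n ω‖ ^ 2)

/-- The instantaneous rate of cellular link `n` with coherence interval of length `T`, in bits per
channel use. The ergodic rate is its expectation. -/
def rate (X : Channels Ω N K B τ) (P : Measure Ω) (T : ℝ) (A : Finset (Fin N))
    (G : Finset (Fin τ)) (n : Fin N) (ω : Ω) : ℝ :=
  (1 - τ / T) * Real.logb 2 (1 + s.sinr X P A G n ω)

/-- `φ_n^{(c)} = (B - b_c - b_d - 1) u_n δ_n`. -/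
def phiC (B bc bd : ℕ) (n : Fin N) : ℝ :=
  ((B : ℝ) - bc - bd - 1) * s.uc n * s.deltaC n

/-- `φ_{an}^{(c)}`: `u_a` if `a ≠ n` is not cancelled, and `u_a ε_a` otherwise. -/
def varphiC (A : Finset (Fin N)) (a n : Fin N) : ℝ :=
  if a ∈ Aᶜ \ {n} then s.uc a else s.uc a * s.epsC a

/-- `φ_i^{(d)}`: `u_i` if pair `i` is not cancelled, and `u_i ε_i` otherwise. -/
def varphiD (G : Finset (Fin τ)) (i : Fin K) : ℝ :=
  if i ∈ s.uncancelledD G then s.ud i else s.ud i * s.epsD i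

/-- `σ^{(c)}`. -/
def sigmaC (G : Finset (Fin τ)) : ℝ := ∑ i, s.ps i * s.varphiD G i + s.N0

/-- `η_n^{(c,lb)}`. -/
def sinrLB (B bc bd : ℕ) (A : Finset (Fin N)) (G : Finset (Fin τ)) (n : Fin N) : ℝ :=
  s.qs n * s.phiC B bc bd n / (∑ a, s.qs a * s.varphiC A a n + s.sigmaC G)

end System

end D2D

end

open MeasureTheory ProbabilityTheory

noncomputable section

namespace D2D

/-! Correlate `Y` with the orthonormal pilots. This gives one vector `obs X t` per pilot. These
vectors are uncorrelated linear mixtures of independent circular Gaussians, hence independent and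
`CN(0, obsVar t)` (`map_mixture_eq_pi`, `map_obs`). Since `Y` can be recovered from them, the MMSE
estimate of a channel is a multiple of the observation along its own pilot (`condExp_channel`).
Users of one pilot thus have parallel estimates, and the cancelled ones span at most `b = b_c + b_d`
dimensions.

What remains concerns independent Gaussian vectors. Let `v` be the projected estimate and write the
SINR as `1 / X`, with `X` the interference plus noise over `w n * ‖v‖ ^ 2`. As `x ↦ log (1 + 1/x)`
is convex and decreasing, it suffices to show `E X ≤ M`, where `1 / M` is the claimed SINR. Two
facts give this. An interferer's observation enters neither the filter nor `v`, so averaging over it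
first replaces its gain by its variance (`lintegral_interference_le`). With the cancelled span
frozen, `v` is a scaled Gaussian in dimension at least `B - b`, and `E ‖v‖⁻² ≤ 1 / (a² c (B - b -
1))` (`lintegral_inv_norm_sq_zfVec_le`).

The stated denominator then appears because `u δ + u ε = u` for each uncancelled interferer. If the
signal amplitude vanishes or `B = b + 1`, the bound is zero and only nonnegativity of the rate is
needed. -/

/-! ### Circular normal laws through characteristic functions -/

instance isProbabilityMeasure_complexNormal (v : ℝ) : IsProbabilityMeasure (complexNormal v) :=
  Measure.isProbabilityMeasure_map
    (by fun_prop : Measurable fun p : ℝ × ℝ => Complex.measurableEquivRealProd.symm p).aemeasurable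

instance isProbabilityMeasure_complexNormalVec (B : ℕ) (v : ℝ) :
    IsProbabilityMeasure (complexNormalVec B v) :=
  Measure.isProbabilityMeasure_map (by fun_prop)

theorem complexNormal_eq_map_measurableEquiv (v : ℝ) :
    complexNormal v = ((gaussianReal 0 (v / 2).toNNReal).prod
      (gaussianReal 0 (v / 2).toNNReal)).map Complex.measurableEquivRealProd.symm := rfl

/-- The constant is `4` because each real coordinate has variance `v / 2` and a real Gaussian
contributes a further factor `1 / 2`. -/
theorem charFun_complexNormal {v : ℝ} (hv : 0 ≤ v) (t : ℂ) :
    charFun (complexNormal v) t = Complex.exp (((-(v * ‖t‖ ^ 2 / 4) : ℝ)) : ℂ) := by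
  rw [complexNormal_eq_map_measurableEquiv, charFun_apply, integral_map_equiv]
  have h1 : ∀ p : ℝ × ℝ,
      Complex.exp ((inner ℝ (Complex.measurableEquivRealProd.symm p) t : ℝ) * Complex.I)
        = Complex.exp (t.re * p.1 * Complex.I) * Complex.exp (t.im * p.2 * Complex.I) := by
    intro p
    rw [← Complex.exp_add, Complex.inner]
    congr 1
    simp [Complex.measurableEquivRealProd]
    ring
  simp_rw [h1]
  rw [integral_prod_mul (fun x : ℝ => Complex.exp (t.re * x * Complex.I))
    (fun x : ℝ => Complex.exp (t.im * x * Complex.I)), ← charFun_apply_real, ← charFun_apply_real,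
    charFun_gaussianReal, charFun_gaussianReal, ← Complex.exp_add]
  congr 1
  have h2 : ((v / 2).toNNReal : ℝ) = v / 2 := Real.coe_toNNReal _ (by positivity)
  have h3 : (((v / 2).toNNReal : ℝ) : ℂ) = v / 2 := by rw [h2]; push_cast; rfl
  rw [h3, ← Complex.normSq_eq_norm_sq, Complex.normSq_apply]
  push_cast
  ring

theorem charFun_complexNormalVec (B : ℕ) {v : ℝ} (hv : 0 ≤ v) (t : EuclideanSpace ℂ (Fin B)) :
    charFun (complexNormalVec B v) t = Complex.exp (((-(v * ‖t‖ ^ 2 / 4) : ℝ)) : ℂ) := by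
  rw [complexNormalVec, charFun_pi]
  simp_rw [charFun_complexNormal hv]
  rw [← Complex.exp_sum, ← Complex.ofReal_sum, EuclideanSpace.norm_sq_eq, Finset.mul_sum,
    Finset.sum_div, Finset.sum_neg_distrib]

theorem real_inner_eq_re_inner {ι : Type*} [Fintype ι] (x y : EuclideanSpace ℂ ι) :
    inner ℝ x y = (inner ℂ x y).re := by
  simp [PiLp.inner_apply, Complex.inner, mul_comm]

/-- Complex linear mixtures of independent circularly symmetric normal vectors are independent
circularly symmetric normal vectors as soon as they are uncorrelated. -/
theorem map_mixture_eq_pi {Ω I J : Type*} [MeasurableSpace Ω] {P : Measure Ω}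
    [IsProbabilityMeasure P] [Fintype I] [Fintype J] [DecidableEq I] {B : ℕ}
    {X : J → Ω → EuclideanSpace ℂ (Fin B)} (hXm : ∀ j, Measurable (X j)) (hX : iIndepFun X P)
    {v : J → ℝ} (hv : ∀ j, 0 ≤ v j) (hlaw : ∀ j, P.map (X j) = complexNormalVec B (v j))
    (M : I → J → ℂ) {c : I → ℝ} (hc : ∀ i, 0 ≤ c i)
    (hM : ∀ i i', ∑ j, M i j * star (M i' j) * v j = if i = i' then (c i : ℂ) else 0) :
    P.map (fun ω i => ∑ j, M i j • X j ω) = Measure.pi (fun i => complexNormalVec B (c i)) := by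
  have hWm : Measurable (fun ω i => ∑ j, M i j • X j ω) := by fun_prop
  have : IsProbabilityMeasure (P.map (fun ω i => ∑ j, M i j • X j ω)) :=
    Measure.isProbabilityMeasure_map hWm.aemeasurable
  rw [← charFun_eq_pi_iff]
  intro t
  -- `u` is the adjoint mixture of `t`: pairing the mixed family with `t` equals pairing the
  -- independent family with `u`, whose characteristic function factors.
  set u : PiLp 2 (fun _ : J => EuclideanSpace ℂ (Fin B)) :=
    WithLp.toLp 2 (fun j => ∑ i, star (M i j) • t i) with hu
  have hjoint := (iIndepFun_iff_charFun_pi (fun j => (hXm j).aemeasurable)).1 hX u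
  have hinner : ∀ ω, inner ℝ (WithLp.toLp 2 (fun i => ∑ j, M i j • X j ω)) t
      = inner ℝ (WithLp.toLp 2 (fun j => X j ω)) u := by
    intro ω
    rw [PiLp.inner_apply, PiLp.inner_apply]
    simp only [real_inner_eq_re_inner,
      hu, sum_inner, inner_sum, inner_smul_left, inner_smul_right]
    rw [Finset.sum_comm]
    rfl
  rw [Measure.map_map (by fun_prop) hWm, charFun_apply, integral_map (by fun_prop) (by fun_prop)]
  rw [charFun_apply, integral_map (by fun_prop) (by fun_prop)] at hjoint
  simp only [Function.comp_apply, hinner]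
  rw [hjoint]
  simp only [hlaw, charFun_complexNormalVec B (hv _), charFun_complexNormalVec B (hc _)]
  rw [← Complex.exp_sum, ← Complex.exp_sum, ← Complex.ofReal_sum, ← Complex.ofReal_sum]
  congr 2
  -- The quadratic form in `u`, expanded in `t`, has coefficients given by `hM`; uncorrelatedness
  -- removes the cross terms.
  have key : ∑ j, (v j : ℂ) * inner ℂ (u j) (u j) = ∑ i, (c i : ℂ) * inner ℂ (t i) (t i) := by
    have h1 : ∀ j, (v j : ℂ) * inner ℂ (u j) (u j)
        = ∑ i, ∑ i', M i j * star (M i' j) * v j * inner ℂ (t i) (t i') := by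
      intro j
      simp only [hu, sum_inner, inner_sum, inner_smul_left, inner_smul_right, Finset.mul_sum]
      rw [Finset.sum_comm]
      refine Finset.sum_congr rfl fun i _ => Finset.sum_congr rfl fun i' _ => ?_
      simp
      ring
    simp_rw [h1]
    rw [Finset.sum_comm]
    refine Finset.sum_congr rfl fun i _ => ?_
    rw [Finset.sum_comm]
    simp_rw [← Finset.sum_mul, hM]
    simp
  have key' : ∑ j, v j * ‖u j‖ ^ 2 = ∑ i, c i * ‖t i‖ ^ 2 := by
    simp only [inner_self_eq_norm_sq_to_K] at key
    refine Complex.ofReal_injective ?_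
    push_cast
    exact key
  rw [Finset.sum_neg_distrib, Finset.sum_neg_distrib, ← Finset.sum_div, ← Finset.sum_div, key']

/-- The coordinates of a circularly symmetric normal vector along an orthonormal family are again
circularly symmetric normal. -/
theorem complexNormalVec_map_inner_orthonormal {B m : ℕ} {c : ℝ} (hc : 0 ≤ c)
    {e : Fin m → EuclideanSpace ℂ (Fin B)} (he : Orthonormal ℂ e) :
    (complexNormalVec B c).map (fun y => WithLp.toLp 2 (fun k => inner ℂ (e k) y))
      = complexNormalVec m c := by
  have hm : Measurable (fun y : EuclideanSpace ℂ (Fin B) =>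
      (WithLp.toLp 2 (fun k => inner ℂ (e k) y) : EuclideanSpace ℂ (Fin m))) := by fun_prop
  have : IsProbabilityMeasure ((complexNormalVec B c).map
      (fun y => (WithLp.toLp 2 (fun k => inner ℂ (e k) y) : EuclideanSpace ℂ (Fin m)))) :=
    Measure.isProbabilityMeasure_map hm.aemeasurable
  refine Measure.ext_of_charFun (funext fun t => ?_)
  have hinner : ∀ y, inner ℝ (WithLp.toLp 2 (fun k => inner ℂ (e k) y) : EuclideanSpace ℂ (Fin m)) t
      = inner ℝ y (∑ k, t k • e k) := by
    intro y
    rw [real_inner_eq_re_inner, real_inner_eq_re_inner]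
    simp only [inner_sum, inner_smul_right, PiLp.inner_apply _ t, RCLike.inner_apply,
      inner_conj_symm]
  have hnorm : ‖∑ k, t k • e k‖ ^ 2 = ‖t‖ ^ 2 := by
    have := he.inner_sum t t Finset.univ
    rw [inner_self_eq_norm_sq_to_K] at this
    rw [EuclideanSpace.norm_sq_eq t]
    simp only [Complex.conj_mul'] at this
    refine Complex.ofReal_injective ?_
    push_cast
    exact this
  rw [charFun_apply, integral_map hm.aemeasurable (by fun_prop)]
  simp only [hinner]
  rw [← charFun_apply, charFun_complexNormalVec B hc, charFun_complexNormalVec m hc, hnorm]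

/-! ### Inverse moments of the squared norm, by Laplace transform -/

theorem integral_exp_neg_mul_sq_gaussianReal {v : NNReal} (hv : v ≠ 0) {s : ℝ} (hs : 0 ≤ s) :
    ∫ x, Real.exp (-(s * x ^ 2)) ∂(gaussianReal 0 v) = (√(1 + 2 * v * s))⁻¹ := by
  have hv' : (0 : ℝ) < v := by positivity
  have h1 : ∀ x : ℝ, gaussianPDFReal 0 v x • Real.exp (-(s * x ^ 2))
      = (√(2 * Real.pi * v))⁻¹ * Real.exp (-(s + 1 / (2 * v)) * x ^ 2) := by
    intro x
    rw [gaussianPDFReal_def, smul_eq_mul, mul_assoc, ← Real.exp_add]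
    congr 2
    field_simp
    ring
  rw [integral_gaussianReal_eq_integral_smul hv]
  simp_rw [h1]
  rw [integral_const_mul, integral_gaussian, ← Real.sqrt_inv, ← Real.sqrt_inv,
    ← Real.sqrt_mul (by positivity)]
  congr 1
  have : (0 : ℝ) < 1 + 2 * v * s := by positivity
  have := Real.pi_pos
  field_simp
  ring

theorem integral_exp_neg_mul_norm_sq_complexNormal {c s : ℝ} (hc : 0 < c) (hs : 0 ≤ s) :
    ∫ z, Real.exp (-(s * ‖z‖ ^ 2)) ∂(complexNormal c) = (1 + c * s)⁻¹ := by
  have hv : (c / 2).toNNReal ≠ 0 := (Real.toNNReal_pos.2 (by positivity)).ne'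
  have h1 : ∀ p : ℝ × ℝ, Real.exp (-(s * ‖Complex.measurableEquivRealProd.symm p‖ ^ 2))
      = Real.exp (-(s * p.1 ^ 2)) * Real.exp (-(s * p.2 ^ 2)) := by
    intro p
    rw [← Real.exp_add, ← Complex.normSq_eq_norm_sq, Complex.normSq_apply]
    congr 1
    simp [Complex.measurableEquivRealProd]
    ring
  rw [complexNormal_eq_map_measurableEquiv, integral_map_equiv]
  simp_rw [h1]
  rw [integral_prod_mul (fun x : ℝ => Real.exp (-(s * x ^ 2))) (fun x : ℝ => Real.exp (-(s * x ^ 2))),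
    integral_exp_neg_mul_sq_gaussianReal hv hs, ← mul_inv, Real.mul_self_sqrt (by positivity),
    Real.coe_toNNReal _ (by positivity)]
  congr 1
  ring

theorem lintegral_exp_neg_mul_norm_sq_complexNormalVec (m : ℕ) {c s : ℝ} (hc : 0 < c) (hs : 0 ≤ s) :
    ∫⁻ w, ENNReal.ofReal (Real.exp (-(s * ‖w‖ ^ 2))) ∂(complexNormalVec m c)
      = ENNReal.ofReal ((1 + c * s)⁻¹ ^ m) := by
  have hint : Integrable (fun w : EuclideanSpace ℂ (Fin m) => Real.exp (-(s * ‖w‖ ^ 2)))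
      (complexNormalVec m c) := by
    refine Integrable.of_bound (by fun_prop) 1 (ae_of_all _ fun w => ?_)
    rw [Real.norm_of_nonneg (Real.exp_pos _).le, Real.exp_le_one_iff]
    have : 0 ≤ s * ‖w‖ ^ 2 := by positivity
    linarith
  rw [← ofReal_integral_eq_lintegral_ofReal hint (ae_of_all _ fun w => (Real.exp_pos _).le)]
  congr 1
  rw [complexNormalVec, integral_map (by fun_prop) (by fun_prop)]
  have h1 : ∀ w : Fin m → ℂ, Real.exp (-(s * ‖WithLp.toLp 2 w‖ ^ 2))
      = ∏ k, Real.exp (-(s * ‖w k‖ ^ 2)) := by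
    intro w
    rw [← Real.exp_sum, EuclideanSpace.norm_sq_eq, Finset.mul_sum, Finset.sum_neg_distrib]
  simp_rw [h1]
  rw [integral_fintype_prod_eq_pow (fun z : ℂ => Real.exp (-(s * ‖z‖ ^ 2))),
    integral_exp_neg_mul_norm_sq_complexNormal hc hs, Fintype.card_fin]

/-- This turns an inverse moment into an integral of Laplace transforms. At `r = 0` both sides are
infinite. -/
theorem inv_ofReal_le_lintegral_exp {r : ℝ} (hr : 0 ≤ r) :
    (ENNReal.ofReal r)⁻¹ ≤ ∫⁻ s in Set.Ioi (0 : ℝ), ENNReal.ofReal (Real.exp (-(s * r))) := by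
  rcases hr.eq_or_lt with rfl | hr
  · simp
  · have h1 : IntegrableOn (fun s => Real.exp (-(s * r))) (Set.Ioi 0) := by
      simpa [mul_comm] using integrableOn_exp_mul_Ioi (neg_lt_zero.2 hr) 0
    rw [← ofReal_integral_eq_lintegral_ofReal h1 (ae_of_all _ fun w => (Real.exp_pos _).le),
      ← ENNReal.ofReal_inv_of_pos hr]
    have h2 := integral_exp_mul_Ioi (neg_lt_zero.2 hr) 0
    refine ENNReal.ofReal_le_ofReal (le_of_eq ?_)
    rw [show (fun s : ℝ => Real.exp (-(s * r))) = fun s => Real.exp (-r * s) by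
      ext s; congr 1; ring, h2]
    simp

/-- The exponent is the complex dimension; it must be at least two for the integral to converge,
hence the form `k + 2`. -/
theorem lintegral_inv_one_add_pow {c : ℝ} (hc : 0 < c) (k : ℕ) :
    ∫⁻ s in Set.Ioi (0 : ℝ), ENNReal.ofReal ((1 + c * s)⁻¹ ^ (k + 2))
      = ENNReal.ofReal (1 / (c * (k + 1))) := by
  have hder : ∀ s ∈ Set.Ici (0 : ℝ),
      HasDerivAt (fun s => -(1 / (c * (k + 1))) * (1 + c * s)⁻¹ ^ (k + 1))
        ((1 + c * s)⁻¹ ^ (k + 2)) s := by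
    intro s hs
    have hs : (0 : ℝ) ≤ s := hs
    have hpos : (0 : ℝ) < 1 + c * s := by positivity
    have h1 : HasDerivAt (fun s => 1 + c * s) c s := by
      simpa using ((hasDerivAt_id s).const_mul c).const_add 1
    have h2 := ((h1.fun_inv hpos.ne').fun_pow (k + 1)).const_mul (-(1 / (c * (k + 1))))
    refine h2.congr_deriv ?_
    have : (k : ℝ) + 1 ≠ 0 := by positivity
    rw [Nat.add_sub_cancel, pow_add]
    push_cast
    field_simp
  have hnn : ∀ s ∈ Set.Ioi (0 : ℝ), 0 ≤ (1 + c * s)⁻¹ ^ (k + 2) := by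
    intro s hs
    have hs : (0 : ℝ) < s := hs
    positivity
  have hlim : Filter.Tendsto (fun s => -(1 / (c * (k + 1))) * (1 + c * s)⁻¹ ^ (k + 1))
      Filter.atTop (nhds 0) := by
    have h1 : Filter.Tendsto (fun s => 1 + c * s) Filter.atTop Filter.atTop :=
      Filter.tendsto_atTop_add_const_left _ _ (Filter.tendsto_id.const_mul_atTop hc)
    simpa using ((h1.inv_tendsto_atTop).pow (k + 1)).const_mul (-(1 / (c * (k + 1))))
  rw [← ofReal_integral_eq_lintegral_ofReal (integrableOn_Ioi_deriv_of_nonneg' hder hnn hlim)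
    ((ae_restrict_iff' measurableSet_Ioi).2 (ae_of_all _ hnn)),
    integral_Ioi_of_hasDerivAt_of_nonneg' hder hnn hlim]
  simp

theorem lintegral_inv_norm_sq_complexNormalVec_le {c : ℝ} (hc : 0 < c) (k : ℕ) :
    ∫⁻ w, (ENNReal.ofReal (‖w‖ ^ 2))⁻¹ ∂(complexNormalVec (k + 2) c)
      ≤ ENNReal.ofReal (1 / (c * (k + 1))) := by
  calc ∫⁻ w, (ENNReal.ofReal (‖w‖ ^ 2))⁻¹ ∂(complexNormalVec (k + 2) c)
      ≤ ∫⁻ w, (∫⁻ s in Set.Ioi (0 : ℝ), ENNReal.ofReal (Real.exp (-(s * ‖w‖ ^ 2))))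
          ∂(complexNormalVec (k + 2) c) :=
        lintegral_mono fun w => inv_ofReal_le_lintegral_exp (by positivity)
    _ = ∫⁻ s in Set.Ioi (0 : ℝ), ∫⁻ w, ENNReal.ofReal (Real.exp (-(s * ‖w‖ ^ 2)))
          ∂(complexNormalVec (k + 2) c) := lintegral_lintegral_swap (by fun_prop)
    _ = ∫⁻ s in Set.Ioi (0 : ℝ), ENNReal.ofReal ((1 + c * s)⁻¹ ^ (k + 2)) :=
        setLIntegral_congr_fun measurableSet_Ioi fun s hs =>
          lintegral_exp_neg_mul_norm_sq_complexNormalVec _ hc (le_of_lt hs)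
    _ = ENNReal.ofReal (1 / (c * (k + 1))) := lintegral_inv_one_add_pow hc k

/-- The mean inverse squared norm of the projection of a circularly symmetric normal vector onto
the orthogonal complement of a subspace of dimension at most `b`. -/
theorem lintegral_inv_norm_sq_starProjection_orthogonal_le {B b : ℕ} (hb : b + 2 ≤ B) {c : ℝ}
    (hc : 0 < c) (S : Submodule ℂ (EuclideanSpace ℂ (Fin B))) (hS : Module.finrank ℂ S ≤ b) :
    ∫⁻ y, (ENNReal.ofReal (‖Sᗮ.starProjection y‖ ^ 2))⁻¹ ∂(complexNormalVec B c)
      ≤ ENNReal.ofReal (1 / (c * ((B : ℝ) - b - 1))) := by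
  obtain ⟨k, hk⟩ : ∃ k, Module.finrank ℂ Sᗮ = k + 2 := by
    have := S.finrank_add_finrank_orthogonal
    rw [finrank_euclideanSpace_fin] at this
    exact ⟨Module.finrank ℂ Sᗮ - 2, by omega⟩
  -- Only an inequality, since dependent spanning vectors leave a larger complement; that only
  -- lowers the inverse moment.
  have hkb : (B : ℝ) - b - 1 ≤ k + 1 := by
    have := S.finrank_add_finrank_orthogonal
    rw [finrank_euclideanSpace_fin, hk] at this
    have h2 : B ≤ b + (k + 2) := by omega
    have h3 : (B : ℝ) ≤ b + (k + 2) := by exact_mod_cast h2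
    linarith
  have hb' : (0 : ℝ) < (B : ℝ) - b - 1 := by
    have : (b : ℝ) + 2 ≤ B := by exact_mod_cast hb
    linarith
  let e : OrthonormalBasis (Fin (k + 2)) ℂ Sᗮ :=
    (stdOrthonormalBasis ℂ Sᗮ).reindex (finCongr hk)
  have he : Orthonormal ℂ (fun j => (e j : EuclideanSpace ℂ (Fin B))) :=
    e.orthonormal.comp_linearIsometry Sᗮ.subtypeₗᵢ
  have hnorm : ∀ y, ‖Sᗮ.starProjection y‖ ^ 2
      = ‖(WithLp.toLp 2 (fun j => inner ℂ (e j : EuclideanSpace ℂ (Fin B)) y) :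
          EuclideanSpace ℂ (Fin (k + 2)))‖ ^ 2 := by
    intro y
    rw [EuclideanSpace.norm_sq_eq (𝕜 := ℂ) (n := Fin (k + 2)), Submodule.starProjection_apply,
      ← Submodule.coe_norm, ← e.sum_sq_norm_inner_right]
    simp only [Submodule.inner_orthogonalProjectionOnto_eq_of_mem_left]
  simp_rw [hnorm]
  rw [← lintegral_map (f := fun w : EuclideanSpace ℂ (Fin (k + 2)) =>
    (ENNReal.ofReal (‖w‖ ^ 2))⁻¹) (by fun_prop) (by fun_prop),
    complexNormalVec_map_inner_orthonormal hc.le he]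
  refine (lintegral_inv_norm_sq_complexNormalVec_le hc k).trans (ENNReal.ofReal_le_ofReal ?_)
  gcongr

/-! ### Second moments and mean -/

theorem lintegral_norm_sq_complexNormal {c : ℝ} (hc : 0 ≤ c) :
    ∫⁻ z, ENNReal.ofReal (‖z‖ ^ 2) ∂(complexNormal c) = ENNReal.ofReal c := by
  have hreal : ∫⁻ x, ENNReal.ofReal (x ^ 2) ∂(gaussianReal 0 (c / 2).toNNReal)
      = ENNReal.ofReal (c / 2) := by
    have h0 : MemLp id 2 (gaussianReal 0 (c / 2).toNNReal) := memLp_id_gaussianReal 2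
    have h2 : Integrable (fun x : ℝ => x ^ 2) (gaussianReal 0 (c / 2).toNNReal) :=
      h0.integrable_sq
    rw [← ofReal_integral_eq_lintegral_ofReal h2 (ae_of_all _ fun w => by positivity)]
    congr 1
    have h1 := variance_of_integral_eq_zero (X := id) (μ := gaussianReal 0 (c / 2).toNNReal)
      aemeasurable_id integral_id_gaussianReal
    rw [variance_id_gaussianReal, Real.coe_toNNReal _ (by positivity)] at h1
    exact h1.symm
  have h1 : ∀ p : ℝ × ℝ, ENNReal.ofReal (‖Complex.measurableEquivRealProd.symm p‖ ^ 2)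
      = ENNReal.ofReal (p.1 ^ 2) + ENNReal.ofReal (p.2 ^ 2) := by
    intro p
    rw [← ENNReal.ofReal_add (by positivity) (by positivity), ← Complex.normSq_eq_norm_sq,
      Complex.normSq_apply]
    congr 1
    simp [Complex.measurableEquivRealProd]
    ring
  rw [complexNormal_eq_map_measurableEquiv, lintegral_map_equiv]
  simp_rw [h1]
  rw [lintegral_add_left (by fun_prop), ← lintegral_map (f := fun x : ℝ => ENNReal.ofReal (x ^ 2))
    (by fun_prop) measurable_fst, ← lintegral_map (f := fun x : ℝ => ENNReal.ofReal (x ^ 2))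
    (by fun_prop) measurable_snd, measurePreserving_fst.map_eq, measurePreserving_snd.map_eq, hreal,
    ← ENNReal.ofReal_add (by positivity) (by positivity)]
  congr 1
  ring

theorem complexNormalVec_map_apply (B : ℕ) (c : ℝ) (k : Fin B) :
    (complexNormalVec B c).map (fun y => y k) = complexNormal c := by
  rw [complexNormalVec, Measure.map_map (by fun_prop) (by fun_prop)]
  exact (measurePreserving_eval (fun _ : Fin B => complexNormal c) k).map_eq

theorem lintegral_norm_sq_complexNormalVec (B : ℕ) {c : ℝ} (hc : 0 ≤ c) :
    ∫⁻ y, ENNReal.ofReal (‖y‖ ^ 2) ∂(complexNormalVec B c) = ENNReal.ofReal (B * c) := by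
  have h1 : ∀ y : EuclideanSpace ℂ (Fin B), ENNReal.ofReal (‖y‖ ^ 2)
      = ∑ k, ENNReal.ofReal (‖y k‖ ^ 2) := by
    intro y
    rw [EuclideanSpace.norm_sq_eq, ENNReal.ofReal_sum_of_nonneg fun _ _ => by positivity]
  simp_rw [h1]
  rw [lintegral_finsetSum _ (by fun_prop)]
  have h2 : ∀ k : Fin B, ∫⁻ y, ENNReal.ofReal (‖y k‖ ^ 2) ∂(complexNormalVec B c)
      = ENNReal.ofReal c := by
    intro k
    rw [← lintegral_norm_sq_complexNormal hc, ← complexNormalVec_map_apply B c k,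
      lintegral_map (by fun_prop) (by fun_prop)]
  simp_rw [h2]
  simp [ENNReal.ofReal_mul]

theorem lintegral_norm_inner_sq_complexNormalVec {B : ℕ} {c : ℝ} (hc : 0 ≤ c)
    {β : EuclideanSpace ℂ (Fin B)} (hβ : ‖β‖ = 1) :
    ∫⁻ y, ENNReal.ofReal (‖inner ℂ β y‖ ^ 2) ∂(complexNormalVec B c) = ENNReal.ofReal c := by
  have he : Orthonormal ℂ (fun _ : Fin 1 => β) :=
    ⟨fun _ => hβ, fun i j hij => absurd (Subsingleton.elim i j) hij⟩
  have h1 := lintegral_norm_sq_complexNormalVec 1 hc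
  rw [← complexNormalVec_map_inner_orthonormal hc he, lintegral_map (by fun_prop) (by fun_prop)] at h1
  simpa [EuclideanSpace.norm_sq_eq] using h1

theorem memLp_two_id_complexNormalVec (B : ℕ) {c : ℝ} (hc : 0 ≤ c) :
    MemLp id 2 (complexNormalVec B c) := by
  rw [memLp_two_iff_integrable_sq_norm (by fun_prop)]
  refine ⟨by fun_prop, ?_⟩
  rw [hasFiniteIntegral_iff_ofReal (ae_of_all _ fun _ => by positivity)]
  simp only [id, lintegral_norm_sq_complexNormalVec B hc, ENNReal.ofReal_lt_top]

/-- The characteristic function depends only on the norm, so the law is symmetric under negation and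
its mean equals its own negative. -/
theorem integral_id_complexNormalVec (B : ℕ) {c : ℝ} (hc : 0 ≤ c) :
    ∫ y, y ∂(complexNormalVec B c) = 0 := by
  have hneg : (complexNormalVec B c).map (fun y => -y) = complexNormalVec B c := by
    have : IsProbabilityMeasure ((complexNormalVec B c).map (fun y => -y)) :=
      Measure.isProbabilityMeasure_map (by fun_prop)
    refine Measure.ext_of_charFun (funext fun t => ?_)
    rw [charFun_apply, integral_map (by fun_prop) (by fun_prop)]
    simp only [inner_neg_left, ← inner_neg_right]
    rw [← charFun_apply, charFun_complexNormalVec B hc, charFun_complexNormalVec B hc, norm_neg]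
  have h1 : ∫ y, y ∂(complexNormalVec B c) = -∫ y, y ∂(complexNormalVec B c) := by
    conv_lhs => rw [← hneg, integral_map (by fun_prop) (by fun_prop), integral_neg]
  have : IsAddTorsionFree (EuclideanSpace ℂ (Fin B)) :=
    .of_isTorsionFree ℝ (EuclideanSpace ℂ (Fin B))
  exact self_eq_neg.1 h1

/-! ### Projection away from a varying span -/

section Projection

variable {E : Type*} [NormedAddCommGroup E] [InnerProductSpace ℂ E] [FiniteDimensional ℂ E]

/-- A Gram–Schmidt step: beyond `s`, the vector `v` contributes only its component orthogonal to
`s`. If that component is zero, division by zero yields the correct coefficient `0`. The explicit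
formula makes projection onto a random complement measurable by induction on the spanning family. -/
theorem starProjection_orthogonal_span_insert (v : E) (s : Set E) (x : E) :
    (Submodule.span ℂ (insert v s))ᗮ.starProjection x
      = (Submodule.span ℂ s)ᗮ.starProjection x
        - (inner ℂ ((Submodule.span ℂ s)ᗮ.starProjection v) x
            / (‖(Submodule.span ℂ s)ᗮ.starProjection v‖ ^ 2 : ℝ))
          • (Submodule.span ℂ s)ᗮ.starProjection v := by
  set S := Submodule.span ℂ s with hS
  set w := Sᗮ.starProjection v with hw
  have hle : S ≤ Submodule.span ℂ (insert v s) := Submodule.span_mono (Set.subset_insert _ _)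
  have hwmem : w ∈ Sᗮ := Submodule.starProjection_apply_mem _ _
  have hres : ∀ z, z - Sᗮ.starProjection z ∈ S := fun z => by
    rw [Submodule.starProjection_orthogonal']
    simp
  set a : ℂ := inner ℂ w x / (‖w‖ ^ 2 : ℝ) with ha
  have hu : Sᗮ.starProjection x - a • w ∈ Sᗮ :=
    Sᗮ.sub_mem (Submodule.starProjection_apply_mem _ _) (Sᗮ.smul_mem _ hwmem)
  refine Submodule.eq_starProjection_of_mem_of_inner_eq_zero ?_ ?_
  · rw [Submodule.mem_orthogonal]
    intro z hz
    rw [Submodule.mem_span_insert] at hz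
    obtain ⟨b, z, hz, rfl⟩ := hz
    have h1 : inner ℂ v (Sᗮ.starProjection x - a • w) = 0 := by
      have h2 : inner ℂ v (Sᗮ.starProjection x - a • w)
          = inner ℂ w (Sᗮ.starProjection x - a • w) := by
        rw [hw, Submodule.inner_starProjection_left_eq_right,
          Submodule.starProjection_eq_self_iff.2 hu]
      have h3 : inner ℂ w (Sᗮ.starProjection x) = inner ℂ w x := by
        rw [← Submodule.inner_starProjection_left_eq_right,
          Submodule.starProjection_eq_self_iff.2 hwmem]
      rw [h2, inner_sub_right, inner_smul_right, h3, inner_self_eq_norm_sq_to_K, ha]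
      rcases eq_or_ne w 0 with h0 | h0
      · simp [h0]
      · have : (‖w‖ : ℂ) ≠ 0 := by simpa using h0
        push_cast
        simp only [Complex.coe_algebraMap]
        field_simp
        simp
    rw [inner_add_left, inner_smul_left, h1, (Submodule.mem_orthogonal _ _).1 hu z hz]
    simp
  · intro z hz
    have hmem : x - (Sᗮ.starProjection x - a • w) ∈ Submodule.span ℂ (insert v s) := by
      have h1 : w ∈ Submodule.span ℂ (insert v s) := by
        have := Submodule.sub_mem _ (Submodule.subset_span (Set.mem_insert v s)) (hle (hres v))
        simpa [hw] using this
      rw [sub_sub_eq_add_sub, add_sub_right_comm]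
      exact Submodule.add_mem _ (hle (hres x)) (Submodule.smul_mem _ _ h1)
    exact (Submodule.mem_orthogonal _ _).1 hz _ hmem

theorem measurable_starProjection_orthogonal_span [MeasurableSpace E] [BorelSpace E]
    {Ω ι : Type*} [MeasurableSpace Ω] {f : ι → Ω → E} (hf : ∀ i, Measurable (f i)) (s : Finset ι)
    {x : Ω → E} (hx : Measurable x) :
    Measurable fun ω =>
      (Submodule.span ℂ ((fun i => f i ω) '' (s : Set ι)))ᗮ.starProjection (x ω) := by
  classical
  have : ProperSpace E := FiniteDimensional.proper ℂ E
  induction s using Finset.induction_on generalizing x with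
  | empty =>
    have h0 : ∀ ω, (Submodule.span ℂ ((fun i => f i ω) ''
        ((∅ : Finset ι) : Set ι)))ᗮ.starProjection (x ω) = x ω := fun ω =>
      Submodule.starProjection_eq_self_iff.2 (by simp)
    simpa only [h0] using hx
  | insert i s _ ih =>
    simp only [Finset.coe_insert, Set.image_insert_eq, starProjection_orthogonal_span_insert]
    have h1 := ih hx
    have h2 := ih (hf i)
    fun_prop

end Projection

/-! ### Averaging over one coordinate, and the tangent-line inequality -/

/-- Fubini in the form of conditioning: all coordinates but `i` are frozen while the `i`-th is
integrated out. -/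
theorem lintegral_pi_eq_lintegral_lintegral_update {ι : Type*} [Fintype ι] [DecidableEq ι]
    {E : ι → Type*} [∀ i, MeasurableSpace (E i)] (μ : ∀ i, Measure (E i))
    [∀ i, IsProbabilityMeasure (μ i)] {f : (∀ i, E i) → ENNReal} (hf : Measurable f) (i : ι) :
    ∫⁻ y, f y ∂(Measure.pi μ) = ∫⁻ y, ∫⁻ z, f (Function.update y i z) ∂(μ i) ∂(Measure.pi μ) := by
  have hg : Measurable fun y => ∫⁻ z, f (Function.update y i z) ∂(μ i) := by
    have := hf.lmarginal μ (s := {i})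
    simpa only [lmarginal_singleton] using this
  have : Nonempty (∀ i, E i) := by
    have := fun i => (nonempty_of_isProbabilityMeasure (μ i))
    infer_instance
  obtain ⟨x⟩ := this
  rw [lintegral_eq_lmarginal_univ (μ := μ) x, lintegral_eq_lmarginal_univ (μ := μ) x]
  rw [← Finset.insert_erase (Finset.mem_univ i),
    lmarginal_insert' _ hf (Finset.notMem_erase _ _),
    lmarginal_insert' _ hg (Finset.notMem_erase _ _)]
  simp

/-- The right side is convex in `x`, and the left side is its tangent at `M`, of slope `-1 / (M (M +
1))`. The slope being negative, an upper bound `M` on the mean is enough for Jensen's inequality. -/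
theorem log_one_add_inv_tangent {x M : ℝ} (hx : 0 < x) (hM : 0 < M) :
    Real.log (1 + 1 / M) - (x - M) / (M * (M + 1)) ≤ Real.log (1 + 1 / x) := by
  have h1 : Real.log (1 + 1 / M) - Real.log (1 + 1 / x) = Real.log ((1 + M) * x / (M * (1 + x))) := by
    rw [← Real.log_div (by positivity) (by positivity)]
    congr 1
    field_simp
    ring
  have h2 := Real.log_le_sub_one_of_pos (show 0 < (1 + M) * x / (M * (1 + x)) by positivity)
  have h3 : (1 + M) * x / (M * (1 + x)) - 1 ≤ (x - M) / (M * (M + 1)) := by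
    rw [← sub_nonneg]
    have : (x - M) / (M * (M + 1)) - ((1 + M) * x / (M * (1 + x)) - 1)
        = (x - M) ^ 2 / (M * (M + 1) * (1 + x)) := by
      field_simp
      ring
    rw [this]
    positivity
  linarith

/-! ### Deterministic bounds and measurability for zero forcing -/

section ZeroForcing

variable {E ι : Type*} [NormedAddCommGroup E] [InnerProductSpace ℂ E] [FiniteDimensional ℂ E]

/-- The component of `h n` orthogonal to the vectors `h j`, `j ∈ C`. -/
def zfVec (h : ι → E) (C : Finset ι) (n : ι) : E :=
  (Submodule.span ℂ (h '' (C : Set ι)))ᗮ.starProjection (h n)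

/-- The zero-forcing filter: the normalization of `zfVec`. -/
def zfDir (h : ι → E) (C : Finset ι) (n : ι) : E :=
  ((‖zfVec h C n‖⁻¹ : ℝ) : ℂ) • zfVec h C n

/-- The interference-plus-noise power after zero forcing, for unit-norm filters. -/
def zfNoise (w : ι → ℝ) (α : ℝ) (h : ι → E) (C U : Finset ι) (n : ι) : ℝ :=
  ∑ j ∈ U, w j * ‖inner ℂ (zfDir h C n) (h j)‖ ^ 2 + α

/-- The signal to interference and noise ratio after zero forcing. -/
def zfSinr (w : ι → ℝ) (α : ℝ) (h : ι → E) (C U : Finset ι) (n : ι) : ℝ :=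
  w n * ‖inner ℂ (zfDir h C n) (h n)‖ ^ 2 /
    (∑ j ∈ U, w j * ‖inner ℂ (zfDir h C n) (h j)‖ ^ 2 + α * ‖zfDir h C n‖ ^ 2)

variable {w : ι → ℝ} {α : ℝ} {C U : Finset ι} {n : ι}

theorem norm_zfDir {h : ι → E} (h0 : zfVec h C n ≠ 0) : ‖zfDir h C n‖ = 1 := by
  rw [zfDir, norm_smul, Complex.norm_real, norm_inv, norm_norm, inv_mul_cancel₀ (by simpa using h0)]

theorem zfDir_eq_zero {h : ι → E} (h0 : zfVec h C n = 0) : zfDir h C n = 0 := by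
  rw [zfDir, h0, smul_zero]

theorem norm_zfVec_le (h : ι → E) : ‖zfVec h C n‖ ≤ ‖h n‖ :=
  Submodule.norm_starProjection_apply_le _ _

/-- The projection is self-adjoint and idempotent, so the filter sees only the component of `h n`
that survives it. -/
theorem norm_inner_zfDir_self (h : ι → E) : ‖inner ℂ (zfDir h C n) (h n)‖ = ‖zfVec h C n‖ := by
  have h1 : inner ℂ (zfVec h C n) (h n) = inner ℂ (zfVec h C n) (zfVec h C n) := by
    rw [zfVec, ← Submodule.inner_starProjection_left_eq_right,
      Submodule.starProjection_eq_self_iff.2 (Submodule.starProjection_apply_mem _ _)]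
  rw [zfDir, inner_smul_left, h1, inner_self_eq_norm_sq_to_K, norm_mul]
  rcases eq_or_ne ‖zfVec h C n‖ 0 with h0 | h0
  · simp [h0]
  · simp
    field_simp

theorem zfNoise_ge (hw : ∀ j, 0 ≤ w j) (h : ι → E) : α ≤ zfNoise w α h C U n :=
  le_add_of_nonneg_left (Finset.sum_nonneg fun j _ => mul_nonneg (hw j) (by positivity))

/-- A nonzero filter has unit norm, so the noise term is exactly `α`; for a zero filter both
numerators vanish, whatever the denominators are. -/
theorem zfSinr_eq_div (w : ι → ℝ) (α : ℝ) (h : ι → E) :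
    zfSinr w α h C U n = w n * ‖zfVec h C n‖ ^ 2 / zfNoise w α h C U n := by
  rw [zfSinr, zfNoise, norm_inner_zfDir_self]
  rcases eq_or_ne (zfVec h C n) 0 with h0 | h0
  · simp [h0]
  · rw [norm_zfDir h0, one_pow, mul_one]

theorem zfSinr_nonneg (hw : ∀ j, 0 ≤ w j) (hα : 0 < α) (h : ι → E) : 0 ≤ zfSinr w α h C U n := by
  rw [zfSinr_eq_div]
  exact div_nonneg (mul_nonneg (hw n) (by positivity)) (hα.le.trans (zfNoise_ge hw h))

theorem zfSinr_le (hw : ∀ j, 0 ≤ w j) (hα : 0 < α) (h : ι → E) :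
    zfSinr w α h C U n ≤ w n / α * ‖h n‖ ^ 2 := by
  rw [zfSinr_eq_div, div_mul_eq_mul_div]
  have := hw n
  gcongr
  · exact norm_zfVec_le h
  · exact zfNoise_ge hw h

variable [MeasurableSpace E] [BorelSpace E] {Ω : Type*} [MeasurableSpace Ω]

theorem measurable_zfVec {h : Ω → ι → E} (hh : ∀ j, Measurable fun ω => h ω j) (C : Finset ι)
    (n : ι) : Measurable fun ω => zfVec (h ω) C n :=
  measurable_starProjection_orthogonal_span (f := fun j ω => h ω j) hh C (hh n)

theorem measurable_zfDir {h : Ω → ι → E} (hh : ∀ j, Measurable fun ω => h ω j) (C : Finset ι)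
    (n : ι) : Measurable fun ω => zfDir (h ω) C n := by
  have := measurable_zfVec hh C n
  have : ProperSpace E := FiniteDimensional.proper ℂ E
  unfold zfDir
  fun_prop

theorem measurable_inner_zfDir {h : Ω → ι → E} (hh : ∀ j, Measurable fun ω => h ω j) (C : Finset ι)
    (n j : ι) : Measurable fun ω => inner ℂ (zfDir (h ω) C n) (h ω j) := by
  have := measurable_zfDir hh C n
  have : ProperSpace E := FiniteDimensional.proper ℂ E
  have := hh j
  fun_prop

theorem measurable_zfNoise {h : Ω → ι → E} (hh : ∀ j, Measurable fun ω => h ω j)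
    (w : ι → ℝ) (α : ℝ) (C U : Finset ι) (n : ι) :
    Measurable fun ω => zfNoise w α (h ω) C U n := by
  have := measurable_inner_zfDir hh C n
  unfold zfNoise
  fun_prop

theorem measurable_zfSinr {h : Ω → ι → E} (hh : ∀ j, Measurable fun ω => h ω j)
    (w : ι → ℝ) (α : ℝ) (C U : Finset ι) (n : ι) :
    Measurable fun ω => zfSinr w α (h ω) C U n := by
  have := measurable_zfVec hh C n
  have := measurable_zfNoise hh w α C U n
  simp only [zfSinr_eq_div]
  fun_prop

/-- Since `log (1 + x) ≤ x`, the rate is dominated by a multiple of `‖h n‖ ^ 2`; no inverse moment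
enters here. -/
theorem integrable_logb_one_add_zfSinr {μ : Measure Ω} {h : Ω → ι → E}
    (hh : ∀ j, Measurable fun ω => h ω j) (hint : Integrable (fun ω => ‖h ω n‖ ^ 2) μ)
    (hw : ∀ j, 0 ≤ w j) (hα : 0 < α) :
    Integrable (fun ω => Real.logb 2 (1 + zfSinr w α (h ω) C U n)) μ := by
  have hm := measurable_zfSinr hh w α C U n
  refine (hint.const_mul (w n / α / Real.log 2)).mono' ?_ (ae_of_all _ fun ω => ?_)
  · unfold Real.logb
    exact (by fun_prop : Measurable _).aestronglyMeasurable
  · have h0 := zfSinr_nonneg (C := C) (U := U) (n := n) hw hα (h ω)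
    have h1 := zfSinr_le (C := C) (U := U) (n := n) hw hα (h ω)
    have h2 : 0 < Real.log 2 := Real.log_pos one_lt_two
    rw [Real.norm_of_nonneg (Real.logb_nonneg one_lt_two (by linarith)), Real.logb,
      div_mul_eq_mul_div]
    have h3 := Real.log_le_sub_one_of_pos (show 0 < 1 + zfSinr w α (h ω) C U n by linarith)
    gcongr
    linarith

end ZeroForcing

/-! ### Zero forcing with independent Gaussian observations -/

section Gaussian

variable {B τ : ℕ} {ι : Type*} {π : ι → Fin τ} {a : ι → ℝ} {c : Fin τ → ℝ} {C U : Finset ι}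
  {n : ι} {b : ℕ}

/-- Scaled copies `a j • y (π j)` of the vectors `y t`. -/
def scaled (a : ι → ℝ) (π : ι → Fin τ) (y : Fin τ → EuclideanSpace ℂ (Fin B)) (j : ι) :
    EuclideanSpace ℂ (Fin B) :=
  (a j : ℂ) • y (π j)

theorem measurable_scaled (a : ι → ℝ) (π : ι → Fin τ) (j : ι) :
    Measurable fun y : Fin τ → EuclideanSpace ℂ (Fin B) => scaled a π y j := by
  unfold scaled
  fun_prop

theorem scaled_image_update {t : Fin τ} (ht : ∀ j ∈ C, π j ≠ t)
    (y : Fin τ → EuclideanSpace ℂ (Fin B)) (z : EuclideanSpace ℂ (Fin B)) :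
    scaled a π (Function.update y t z) '' (C : Set ι) = scaled a π y '' (C : Set ι) :=
  Set.image_congr fun j hj => by rw [scaled, scaled, Function.update_of_ne (ht j hj)]

/-- Estimates sharing a pilot are parallel, so the dimension is bounded by the number of distinct
pilots and not by the number of cancelled users. -/
theorem finrank_span_scaled_le (hb : (C.image π).card ≤ b)
    (y : Fin τ → EuclideanSpace ℂ (Fin B)) :
    Module.finrank ℂ (Submodule.span ℂ (scaled a π y '' (C : Set ι))) ≤ b := by
  classical
  have h1 : Submodule.span ℂ (scaled a π y '' (C : Set ι))
      ≤ Submodule.span ℂ (((C.image π).image y : Finset _) : Set (EuclideanSpace ℂ (Fin B))) := by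
    rw [Submodule.span_le]
    rintro _ ⟨j, hj, rfl⟩
    refine Submodule.smul_mem _ _ (Submodule.subset_span ?_)
    exact Finset.mem_coe.2 (Finset.mem_image_of_mem _ (Finset.mem_image_of_mem _ hj))
  exact (Submodule.finrank_mono h1).trans
    ((finrank_span_finset_le_card _).trans (Finset.card_image_le.trans hb))

theorem lintegral_inv_norm_sq_zfVec_le (hc : ∀ t, 0 < c t) (han : 0 < a n) (hbB : b + 2 ≤ B)
    (hb : (C.image π).card ≤ b) (hn : ∀ j ∈ C, π j ≠ π n) :
    ∫⁻ y, (ENNReal.ofReal (‖zfVec (scaled a π y) C n‖ ^ 2))⁻¹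
        ∂(Measure.pi fun t => complexNormalVec B (c t))
      ≤ ENNReal.ofReal (1 / (a n ^ 2 * c (π n) * ((B : ℝ) - b - 1))) := by
  have hm := measurable_zfVec (measurable_scaled (B := B) a π) C n
  -- No cancelled vector uses the pilot of `n`, so the span `S` stays fixed while that observation
  -- is averaged.
  rw [lintegral_pi_eq_lintegral_lintegral_update _ (by fun_prop) (π n)]
  have h1 : ∀ y : Fin τ → EuclideanSpace ℂ (Fin B),
      ∫⁻ z, (ENNReal.ofReal (‖zfVec (scaled a π (Function.update y (π n) z)) C n‖ ^ 2))⁻¹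
        ∂(complexNormalVec B (c (π n)))
      ≤ ENNReal.ofReal (1 / (a n ^ 2 * c (π n) * ((B : ℝ) - b - 1))) := by
    intro y
    set S := Submodule.span ℂ (scaled a π y '' (C : Set ι))
    have h2 : ∀ z, (ENNReal.ofReal (‖zfVec (scaled a π (Function.update y (π n) z)) C n‖ ^ 2))⁻¹
        = ENNReal.ofReal (1 / a n ^ 2) * (ENNReal.ofReal (‖Sᗮ.starProjection z‖ ^ 2))⁻¹ := by
      intro z
      simp only [zfVec, scaled_image_update hn]
      change (ENNReal.ofReal (‖Sᗮ.starProjection _‖ ^ 2))⁻¹ = _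
      rw [scaled, Function.update_self, map_smul, norm_smul,
        mul_pow, ENNReal.ofReal_mul (by positivity), ENNReal.mul_inv (by simp [han.ne']) (by simp),
        one_div, ENNReal.ofReal_inv_of_pos (by positivity), Complex.norm_real, Real.norm_eq_abs,
        sq_abs]
    simp_rw [h2]
    rw [lintegral_const_mul _ (by fun_prop)]
    refine (mul_le_mul_right (lintegral_inv_norm_sq_starProjection_orthogonal_le hbB (hc _) S
      (finrank_span_scaled_le hb y)) _).trans (le_of_eq ?_)
    rw [← ENNReal.ofReal_mul (by positivity), one_div_mul_one_div, mul_assoc]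
  refine (lintegral_mono h1).trans ?_
  simp

theorem zfVec_update {t : Fin τ} (ht : ∀ j ∈ C, π j ≠ t) (hn : π n ≠ t)
    (y : Fin τ → EuclideanSpace ℂ (Fin B)) (z : EuclideanSpace ℂ (Fin B)) :
    zfVec (scaled a π (Function.update y t z)) C n = zfVec (scaled a π y) C n := by
  simp only [zfVec, scaled_image_update ht]
  rw [scaled, scaled, Function.update_of_ne hn]

/-- The observation on the pilot of `j` affects neither the filter nor `zfVec`. Averaging over it
first leaves the variance of one coordinate along a unit vector (or zero, for a zero filter). -/
theorem lintegral_interference_le (hc : ∀ t, 0 < c t) {j : ι} (hjC : ∀ i ∈ C, π i ≠ π j)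
    (hjn : π n ≠ π j) :
    ∫⁻ y, ENNReal.ofReal (‖inner ℂ (zfDir (scaled a π y) C n) (scaled a π y j)‖ ^ 2)
          * (ENNReal.ofReal (‖zfVec (scaled a π y) C n‖ ^ 2))⁻¹
        ∂(Measure.pi fun t => complexNormalVec B (c t))
      ≤ ENNReal.ofReal (a j ^ 2 * c (π j)) *
        ∫⁻ y, (ENNReal.ofReal (‖zfVec (scaled a π y) C n‖ ^ 2))⁻¹
          ∂(Measure.pi fun t => complexNormalVec B (c t)) := by
  have hm := measurable_zfVec (measurable_scaled (B := B) a π) C n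
  have hm' := measurable_inner_zfDir (measurable_scaled (B := B) a π) C n j
  rw [lintegral_pi_eq_lintegral_lintegral_update _ (by fun_prop) (π j),
    ← lintegral_const_mul _ (by fun_prop)]
  refine lintegral_mono fun y => ?_
  simp only [zfDir, zfVec_update hjC hjn]
  rw [lintegral_mul_const _ (by unfold scaled; fun_prop)]
  gcongr
  rw [← zfDir]
  rcases eq_or_ne (zfVec (scaled a π y) C n) 0 with h0 | h0
  · simp [zfDir_eq_zero h0]
  · have h1 : ∀ z, ENNReal.ofReal
        (‖inner ℂ (zfDir (scaled a π y) C n) (scaled a π (Function.update y (π j) z) j)‖ ^ 2)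
        = ENNReal.ofReal (a j ^ 2)
          * ENNReal.ofReal (‖inner ℂ (zfDir (scaled a π y) C n) z‖ ^ 2) := by
      intro z
      rw [scaled, Function.update_self, inner_smul_right, norm_mul, mul_pow, Complex.norm_real,
        Real.norm_eq_abs, sq_abs, ENNReal.ofReal_mul (by positivity)]
    simp_rw [h1]
    rw [lintegral_const_mul _ (by fun_prop),
      lintegral_norm_inner_sq_complexNormalVec (hc _).le (norm_zfDir h0),
      ENNReal.ofReal_mul (by positivity)]

variable {w : ι → ℝ} {α : ℝ}

/-- The inverse squared norm is `⊤` where the projection vanishes, yet its integral is finite. -/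
theorem ae_zfVec_ne_zero (hc : ∀ t, 0 < c t) (han : 0 < a n) (hbB : b + 2 ≤ B)
    (hb : (C.image π).card ≤ b) (hn : ∀ j ∈ C, π j ≠ π n) :
    ∀ᵐ y ∂(Measure.pi fun t => complexNormalVec B (c t)), zfVec (scaled a π y) C n ≠ 0 := by
  have hm := measurable_zfVec (measurable_scaled (B := B) a π) C n
  have h1 := ae_lt_top (by fun_prop)
    ((lintegral_inv_norm_sq_zfVec_le hc han hbB hb hn).trans_lt ENNReal.ofReal_lt_top).ne
  filter_upwards [h1] with y hy h0
  simp [h0] at hy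

theorem lintegral_inv_sinr_le (hc : ∀ t, 0 < c t) (han : 0 < a n) (hbB : b + 2 ≤ B)
    (hb : (C.image π).card ≤ b) (hn : ∀ j ∈ C, π j ≠ π n)
    (hU : ∀ j ∈ U, π n ≠ π j ∧ ∀ i ∈ C, π i ≠ π j) (hw : ∀ j, 0 ≤ w j) (hwn : 0 < w n)
    (hα : 0 < α) :
    ∫⁻ y, ENNReal.ofReal (zfNoise w α (scaled a π y) C U n / (w n * ‖zfVec (scaled a π y) C n‖ ^ 2))
        ∂(Measure.pi fun t => complexNormalVec B (c t))
      ≤ ENNReal.ofReal ((∑ j ∈ U, w j * (a j ^ 2 * c (π j)) + α)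
          / (w n * (a n ^ 2 * c (π n) * ((B : ℝ) - b - 1)))) := by
  have hm := measurable_zfVec (measurable_scaled (B := B) a π) C n
  have hm' := measurable_inner_zfDir (measurable_scaled (B := B) a π) C n
  set μ := Measure.pi fun t => complexNormalVec B (c t)
  set I := ∫⁻ y, (ENNReal.ofReal (‖zfVec (scaled a π y) C n‖ ^ 2))⁻¹ ∂μ with hI
  -- Equality except where `zfVec` vanishes: there the real quotient is `0` by convention, while the
  -- inverse on the right is `⊤`.
  have hle : ∀ y : Fin τ → EuclideanSpace ℂ (Fin B), ENNReal.ofReal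
      (zfNoise w α (scaled a π y) C U n / (w n * ‖zfVec (scaled a π y) C n‖ ^ 2))
      ≤ ENNReal.ofReal (1 / w n) *
        (∑ j ∈ U, ENNReal.ofReal (w j) *
          (ENNReal.ofReal (‖inner ℂ (zfDir (scaled a π y) C n) (scaled a π y j)‖ ^ 2)
            * (ENNReal.ofReal (‖zfVec (scaled a π y) C n‖ ^ 2))⁻¹)
          + ENNReal.ofReal α * (ENNReal.ofReal (‖zfVec (scaled a π y) C n‖ ^ 2))⁻¹) := by
    intro y
    rcases eq_or_ne (zfVec (scaled a π y) C n) 0 with h0 | h0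
    · simp [h0]
    · have hpos : 0 < ‖zfVec (scaled a π y) C n‖ ^ 2 := by
        have := norm_pos_iff.2 h0
        positivity
      refine le_of_eq ?_
      simp_rw [← mul_assoc]
      rw [← Finset.sum_mul, ← add_mul, ← mul_assoc, ← ENNReal.ofReal_inv_of_pos hpos]
      simp_rw [← ENNReal.ofReal_mul (hw _)]
      rw [← ENNReal.ofReal_sum_of_nonneg (fun j _ => mul_nonneg (hw j) (by positivity)),
        ← ENNReal.ofReal_add
          (Finset.sum_nonneg fun j _ => mul_nonneg (hw j) (by positivity)) hα.le,
        ← ENNReal.ofReal_mul (by positivity), ← ENNReal.ofReal_mul]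
      · congr 1
        rw [zfNoise]
        field_simp
      · refine mul_nonneg (by positivity) (add_nonneg ?_ hα.le)
        exact Finset.sum_nonneg fun j _ => mul_nonneg (hw j) (by positivity)
  have hS : 0 ≤ ∑ j ∈ U, w j * (a j ^ 2 * c (π j)) :=
    Finset.sum_nonneg fun j _ => mul_nonneg (hw j) (mul_nonneg (by positivity) (hc _).le)
  refine (lintegral_mono hle).trans ?_
  rw [lintegral_const_mul _ (by fun_prop), lintegral_add_right _ (by fun_prop),
    lintegral_finsetSum _ (fun j _ => by fun_prop), lintegral_const_mul _ (by fun_prop), ← hI]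
  calc ENNReal.ofReal (1 / w n) * (∑ j ∈ U, (∫⁻ y, ENNReal.ofReal (w j) *
          (ENNReal.ofReal (‖inner ℂ (zfDir (scaled a π y) C n) (scaled a π y j)‖ ^ 2)
            * (ENNReal.ofReal (‖zfVec (scaled a π y) C n‖ ^ 2))⁻¹) ∂μ) + ENNReal.ofReal α * I)
      ≤ ENNReal.ofReal (1 / w n) * (∑ j ∈ U, ENNReal.ofReal (w j * (a j ^ 2 * c (π j))) * I
          + ENNReal.ofReal α * I) := by
        gcongr with j hj
        rw [lintegral_const_mul _ (by fun_prop), ENNReal.ofReal_mul (hw j), mul_assoc]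
        gcongr
        exact lintegral_interference_le hc (hU j hj).2 (hU j hj).1
    _ = ENNReal.ofReal (1 / w n * (∑ j ∈ U, w j * (a j ^ 2 * c (π j)) + α)) * I := by
        rw [← Finset.sum_mul, ← add_mul, ← ENNReal.ofReal_sum_of_nonneg
          (fun j _ => mul_nonneg (hw j) (mul_nonneg (by positivity) (hc _).le)),
          ← ENNReal.ofReal_add hS hα.le, ← mul_assoc, ← ENNReal.ofReal_mul (by positivity)]
    _ ≤ ENNReal.ofReal (1 / w n * (∑ j ∈ U, w j * (a j ^ 2 * c (π j)) + α))
          * ENNReal.ofReal (1 / (a n ^ 2 * c (π n) * ((B : ℝ) - b - 1))) := by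
        gcongr
        exact lintegral_inv_norm_sq_zfVec_le hc han hbB hb hn
    _ = _ := by
        rw [← ENNReal.ofReal_mul (by positivity)]
        congr 1
        rw [one_div_mul_eq_div, div_mul_div_comm, mul_one]

theorem integral_log_one_add_zfSinr_ge (hc : ∀ t, 0 < c t) (han : 0 < a n) (hbB : b + 2 ≤ B)
    (hb : (C.image π).card ≤ b) (hn : ∀ j ∈ C, π j ≠ π n)
    (hU : ∀ j ∈ U, π n ≠ π j ∧ ∀ i ∈ C, π i ≠ π j) (hw : ∀ j, 0 ≤ w j) (hwn : 0 < w n)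
    (hα : 0 < α)
    (hint : Integrable (fun y => Real.log (1 + zfSinr w α (scaled a π y) C U n))
      (Measure.pi fun t => complexNormalVec B (c t))) :
    Real.log (1 + w n * (a n ^ 2 * c (π n) * ((B : ℝ) - b - 1))
        / (∑ j ∈ U, w j * (a j ^ 2 * c (π j)) + α))
      ≤ ∫ y, Real.log (1 + zfSinr w α (scaled a π y) C U n)
        ∂(Measure.pi fun t => complexNormalVec B (c t)) := by
  have hm := measurable_zfVec (measurable_scaled (B := B) a π) C n
  have hm' := measurable_zfNoise (measurable_scaled (B := B) a π) w α C U n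
  have hlint := lintegral_inv_sinr_le hc han hbB hb hn hU hw hwn hα
  set μ := Measure.pi fun t => complexNormalVec B (c t)
  set M := (∑ j ∈ U, w j * (a j ^ 2 * c (π j)) + α)
    / (w n * (a n ^ 2 * c (π n) * ((B : ℝ) - b - 1))) with hM
  have hcn := hc (π n)
  have hb' : (0 : ℝ) < (B : ℝ) - b - 1 := by
    have : (b : ℝ) + 2 ≤ B := by exact_mod_cast hbB
    linarith
  have hS : 0 ≤ ∑ j ∈ U, w j * (a j ^ 2 * c (π j)) :=
    Finset.sum_nonneg fun j _ => mul_nonneg (hw j) (mul_nonneg (by positivity) (hc _).le)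
  have hMpos : 0 < M := by positivity
  set X := fun y : Fin τ → EuclideanSpace ℂ (Fin B) => zfNoise w α (scaled a π y) C U n / (w n * ‖zfVec (scaled a π y) C n‖ ^ 2)
    with hX
  have hXnn : ∀ y : Fin τ → EuclideanSpace ℂ (Fin B), 0 ≤ X y := fun y =>
    div_nonneg (hα.le.trans (zfNoise_ge hw _)) (by positivity)
  have hXint : Integrable X μ := by
    refine ⟨(by fun_prop : Measurable X).aestronglyMeasurable, ?_⟩
    rw [hasFiniteIntegral_iff_ofReal (ae_of_all _ hXnn)]
    exact hlint.trans_lt ENNReal.ofReal_lt_top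
  have hXle : ∫ y, X y ∂μ ≤ M := by
    rw [integral_eq_lintegral_of_nonneg_ae (ae_of_all _ hXnn) hXint.1]
    exact ENNReal.toReal_le_of_le_ofReal hMpos.le hlint
  have hae : ∀ᵐ y ∂μ, Real.log (1 + 1 / M) - (X y - M) / (M * (M + 1))
      ≤ Real.log (1 + zfSinr w α (scaled a π y) C U n) := by
    filter_upwards [ae_zfVec_ne_zero hc han hbB hb hn] with y hy
    have h1 : zfSinr w α (scaled a π y) C U n = 1 / X y := by
      rw [zfSinr_eq_div, hX, one_div_div]
    have h2 : 0 < ‖zfVec (scaled a π y) C n‖ := norm_pos_iff.2 hy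
    rw [h1]
    exact log_one_add_inv_tangent (div_pos (hα.trans_le (zfNoise_ge hw _)) (by positivity)) hMpos
  have h1 := integral_mono_ae (by fun_prop) hint hae
  rw [integral_sub (by fun_prop) (by fun_prop), integral_div, integral_sub hXint (by fun_prop)] at h1
  simp only [integral_const, probReal_univ, one_smul] at h1
  -- The linear term of the tangent can only help, because the mean of `X` is at most `M`.
  have h2 : (∫ y, X y ∂μ - M) / (M * (M + 1)) ≤ 0 :=
    div_nonpos_of_nonpos_of_nonneg (by linarith) (by positivity)
  have h3 : 1 / M = w n * (a n ^ 2 * c (π n) * ((B : ℝ) - b - 1))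
      / (∑ j ∈ U, w j * (a j ^ 2 * c (π j)) + α) := by rw [hM, one_div_div]
  rw [← h3]
  linarith

/-- The ergodic rate after zero forcing with independent circularly symmetric normal channel
estimates. -/
theorem zfRate_integrable_and_ge (hc : ∀ t, 0 < c t) (ha : ∀ j, 0 ≤ a j) (hbB : b + 1 ≤ B)
    (hb : (C.image π).card ≤ b) (hn : ∀ j ∈ C, π j ≠ π n)
    (hU : ∀ j ∈ U, π n ≠ π j ∧ ∀ i ∈ C, π i ≠ π j) (hw : ∀ j, 0 ≤ w j) (hα : 0 < α) :
    Integrable (fun y => Real.logb 2 (1 + zfSinr w α (scaled a π y) C U n))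
        (Measure.pi fun t => complexNormalVec B (c t)) ∧
      Real.logb 2 (1 + w n * (a n ^ 2 * c (π n) * ((B : ℝ) - b - 1))
          / (∑ j ∈ U, w j * (a j ^ 2 * c (π j)) + α))
        ≤ ∫ y, Real.logb 2 (1 + zfSinr w α (scaled a π y) C U n)
          ∂(Measure.pi fun t => complexNormalVec B (c t)) := by
  have hlog : 0 < Real.log 2 := Real.log_pos one_lt_two
  have hsq : Integrable (fun y => ‖scaled a π y n‖ ^ 2)
      (Measure.pi fun t => complexNormalVec B (c t)) := by
    have h1 := (memLp_two_id_complexNormalVec B (hc (π n)).le).integrable_norm_pow (by simp)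
    have h2 := (integrable_comp_eval (μ := fun t => complexNormalVec B (c t)) h1).const_mul (a n ^ 2)
    simpa [scaled, norm_smul, mul_pow] using h2
  have hint := integrable_logb_one_add_zfSinr (C := C) (U := U) (measurable_scaled (B := B) a π)
    hsq hw hα
  refine ⟨hint, ?_⟩
  -- In these cases the inverse-moment bound is unavailable or the signal is zero, but the claimed
  -- lower bound is `log 1 = 0`.
  by_cases hdeg : w n = 0 ∨ a n = 0 ∨ B = b + 1
  · have h0 : w n * (a n ^ 2 * c (π n) * ((B : ℝ) - b - 1)) = 0 := by
      rcases hdeg with h | h | h <;> simp [h]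
    rw [h0, zero_div, add_zero, Real.logb_one]
    refine integral_nonneg fun y => Real.logb_nonneg one_lt_two ?_
    linarith [zfSinr_nonneg (C := C) (U := U) (n := n) hw hα (scaled a π y)]
  · push Not at hdeg
    obtain ⟨h1, h2, h3⟩ := hdeg
    have hint' : Integrable (fun y => Real.log (1 + zfSinr w α (scaled a π y) C U n))
        (Measure.pi fun t => complexNormalVec B (c t)) := by
      refine (hint.mul_const (Real.log 2)).congr (ae_of_all _ fun y => ?_)
      dsimp only
      rw [← Real.log_div_log, div_mul_cancel₀ _ hlog.ne']
    have := integral_log_one_add_zfSinr_ge hc ((ha n).lt_of_ne' h2) (by omega) hb hn hU hw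
      ((hw n).lt_of_ne' h1) hα hint'
    simp only [Real.logb]
    rw [integral_div]
    gcongr

end Gaussian

/-! ### Marginals and independence read off from a product law -/

theorem map_eval_of_map_eq_pi {Ω I F : Type*} [Fintype I] [MeasurableSpace Ω] [MeasurableSpace F]
    {P : Measure Ω} {W : I → Ω → F} (hW : ∀ i, Measurable (W i)) {μ : I → Measure F}
    [∀ i, IsProbabilityMeasure (μ i)] (h : P.map (fun ω i => W i ω) = Measure.pi μ) (i : I) :
    P.map (W i) = μ i := by
  rw [← (measurePreserving_eval μ i).map_eq, ← h, Measure.map_map (by fun_prop) (by fun_prop)]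
  rfl

theorem iIndepFun_of_map_eq_pi {Ω I F : Type*} [Fintype I] [MeasurableSpace Ω] [MeasurableSpace F]
    {P : Measure Ω} [IsProbabilityMeasure P] {W : I → Ω → F} (hW : ∀ i, Measurable (W i))
    {μ : I → Measure F} [∀ i, IsProbabilityMeasure (μ i)]
    (h : P.map (fun ω i => W i ω) = Measure.pi μ) : iIndepFun W P := by
  rw [iIndepFun_iff_map_fun_eq_pi_map fun i => (hW i).aemeasurable, h]
  simp_rw [map_eval_of_map_eq_pi hW h]

theorem indepFun_none_some_of_iIndepFun {Ω I F : Type*} [Fintype I] [MeasurableSpace Ω]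
    [MeasurableSpace F] {P : Measure Ω} {W : Option I → Ω → F} (hW : ∀ i, Measurable (W i))
    (h : iIndepFun W P) : IndepFun (W none) (fun ω i => W (some i) ω) P := by
  classical
  have h1 := h.indepFun_finset {none} {none}ᶜ disjoint_compl_right hW
  exact h1.comp
    (φ := fun x : ({none} : Finset (Option I)) → F => x ⟨none, Finset.mem_singleton_self _⟩)
    (ψ := fun (x : (({none}ᶜ : Finset (Option I)) → F)) (i : I) => x ⟨some i, by simp⟩)
    (measurable_pi_apply _) (measurable_pi_lambda _ fun _ => measurable_pi_apply _)

variable {Ω : Type*} {N K B τ : ℕ}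

/-! ### Pilot observations and MMSE estimation -/

namespace System

variable (s : System N K τ)

/-- Amplitude with which each transmitter (CU or D2D) contributes to the received pilot. -/
def gain : Fin N ⊕ Fin K → ℝ :=
  Sum.elim (fun n => √(s.qp n * s.uc n)) (fun i => √(s.pp i * s.ud i))

/-- Index of the pilot used by each transmitter. -/
def pilotIdx : Fin N ⊕ Fin K → Fin τ :=
  Sum.elim (fun n => Fin.castLE s.tau_gt.le n) s.pilotOf

/-- Variance of the entries of the received pilot matrix correlated with pilot `t`. -/
def obsVar (t : Fin τ) : ℝ := (∑ j, if s.pilotIdx j = t then s.gain j ^ 2 else 0) + s.N0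

/-- Coefficients of the fading vectors and of the noise columns in the received pilot matrix
correlated with pilot `t`. -/
def mix (t : Fin τ) : Fin N ⊕ Fin K ⊕ Fin τ → ℂ :=
  Sum.elim (fun n => if s.pilotIdx (.inl n) = t then (s.gain (.inl n) : ℂ) else 0)
    (Sum.elim (fun i => if s.pilotIdx (.inr i) = t then (s.gain (.inr i) : ℂ) else 0)
      (fun t' => s.pilots t' t))

/-- Variances of the fading vectors and of the noise columns. -/
def allVar : Fin N ⊕ Fin K ⊕ Fin τ → ℝ :=
  Sum.elim (fun _ => 1) (Sum.elim (fun _ => 1) (fun _ => s.N0))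

/-- Position of a transmitter in the family of fading vectors and noise columns. -/
def txIdx : Fin N ⊕ Fin K → Fin N ⊕ Fin K ⊕ Fin τ := Sum.elim .inl (.inr ∘ .inl)

/-- The received pilot matrix correlated with pilot `t`. -/
def obs (X : Channels Ω N K B τ) (t : Fin τ) (ω : Ω) : EuclideanSpace ℂ (Fin B) :=
  WithLp.toLp 2 fun b => ∑ t', s.receivedPilot X ω b t' * s.pilots t' t

theorem allVar_nonneg (j : Fin N ⊕ Fin K ⊕ Fin τ) : 0 ≤ s.allVar j := by
  rcases j with n | i | t
  · exact zero_le_one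
  · exact zero_le_one
  · exact s.N0_pos.le

theorem obsVar_pos (t : Fin τ) : 0 < s.obsVar t :=
  add_pos_of_nonneg_of_pos
    (Finset.sum_nonneg fun j _ => by split_ifs <;> positivity) s.N0_pos

theorem gain_nonneg (j : Fin N ⊕ Fin K) : 0 ≤ s.gain j := by
  rcases j with n | i <;> exact Real.sqrt_nonneg _

theorem sum_star_pilots_mul (t t' : Fin τ) :
    ∑ r, star (s.pilots r t) * s.pilots r t' = if t = t' then 1 else 0 := by
  have h := congrFun (congrFun s.pilots_orthonormal t) t'
  rwa [Matrix.mul_apply, Matrix.one_apply] at h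

/-- The pilot matrix is square, so orthonormal columns force orthonormal rows; this makes
correlation with the pilots invertible. -/
theorem sum_pilots_mul_star (r r' : Fin τ) :
    ∑ t, s.pilots r t * star (s.pilots r' t) = if r = r' then 1 else 0 := by
  have h0 : s.pilots * s.pilots.conjTranspose = 1 := mul_eq_one_comm.1 s.pilots_orthonormal
  have h := congrFun (congrFun h0 r) r'
  rwa [Matrix.mul_apply, Matrix.one_apply] at h

theorem obs_eq_mixture (X : Channels Ω N K B τ) (t : Fin τ) (ω : Ω) :
    s.obs X t ω = ∑ j, s.mix t j • X.all j ω := by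
  ext b
  have hpil : ∀ (k : Fin τ) (x : ℂ),
      ∑ t', x * star (s.pilots t' k) * s.pilots t' t = if k = t then x else 0 := by
    intro k x
    simp_rw [mul_assoc, ← Finset.mul_sum, s.sum_star_pilots_mul]
    simp
  have h1 : ∀ t', s.receivedPilot X ω b t'
      = ∑ n, (s.gain (.inl n) * X.hc n ω b) * star (s.pilots t' (s.pilotIdx (.inl n)))
        + ∑ i, (s.gain (.inr i) * X.hd i ω b) * star (s.pilots t' (s.pilotIdx (.inr i)))
        + X.Z t' ω b := by
    intro t'
    simp only [receivedPilot, Matrix.add_apply, Matrix.sum_apply, Matrix.smul_apply,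
      Matrix.vecMulVec_apply, Matrix.of_apply, smul_eq_mul, mul_assoc]
    rfl
  simp only [obs, h1, add_mul, Finset.sum_mul, Finset.sum_add_distrib]
  rw [Finset.sum_comm, Finset.sum_comm (s := Finset.univ) (t := (Finset.univ : Finset (Fin K)))]
  simp only [hpil]
  simp only [mix, Channels.all, Fintype.sum_sum_type, add_assoc, PiLp.add_apply, WithLp.ofLp_sum,
    Finset.sum_apply, Sum.elim_inl, Sum.elim_inr, PiLp.smul_apply, smul_eq_mul, ite_mul, zero_mul]
  simp only [mul_comm (s.pilots _ _)]

/-- No information is lost by correlating, so independence from the observations gives independence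
from `Y`. -/
theorem receivedPilot_eq_sum_obs (X : Channels Ω N K B τ) (ω : Ω) (b : Fin B) (r : Fin τ) :
    s.receivedPilot X ω b r = ∑ t, s.obs X t ω b * star (s.pilots r t) := by
  simp only [obs, Finset.sum_mul]
  rw [Finset.sum_comm]
  simp_rw [mul_assoc, ← Finset.mul_sum, s.sum_pilots_mul_star]
  simp

theorem sum_mix_mul_star_mix (t t' : Fin τ) :
    ∑ j, s.mix t j * star (s.mix t' j) * s.allVar j = if t = t' then (s.obsVar t : ℂ) else 0 := by
  have hN : ∑ r, s.pilots r t * star (s.pilots r t') * (s.N0 : ℂ)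
      = if t = t' then (s.N0 : ℂ) else 0 := by
    rw [← Finset.sum_mul]
    have := s.sum_star_pilots_mul t' t
    simp_rw [mul_comm (star _)] at this
    rw [this]
    simp [eq_comm]
  have hg : ∀ j, (if s.pilotIdx j = t then (s.gain j : ℂ) else 0)
      * star (if s.pilotIdx j = t' then (s.gain j : ℂ) else 0)
      = if t = t' then (if s.pilotIdx j = t then (s.gain j : ℂ) ^ 2 else 0) else 0 := by
    intro j
    by_cases h1 : s.pilotIdx j = t
    · by_cases h2 : t = t'
      · simp [h1, ← h2, sq]
      · simp [h1, h2]
    · simp [h1]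
  simp only [Fintype.sum_sum_type, mix, allVar, Sum.elim_inl, Sum.elim_inr, Complex.ofReal_one,
    mul_one, hg, hN]
  by_cases h : t = t'
  · simp [h, obsVar, Fintype.sum_sum_type, add_assoc, apply_ite]
  · simp [h]

/-- The linear MMSE coefficient of each channel. -/
def estGain (j : Fin N ⊕ Fin K) : ℝ := s.gain j / s.obsVar (s.pilotIdx j)

theorem mix_txIdx (t : Fin τ) (j : Fin N ⊕ Fin K) :
    s.mix t (txIdx j) = if s.pilotIdx j = t then (s.gain j : ℂ) else 0 := by
  rcases j with n | i <;> rfl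

theorem allVar_txIdx (j : Fin N ⊕ Fin K) : s.allVar (txIdx j) = 1 := by
  rcases j with n | i <;> rfl

/-- Coefficients of the estimation error of channel `j` followed by the observations. -/
def errMix (j : Fin N ⊕ Fin K) : Option (Fin τ) → Fin N ⊕ Fin K ⊕ Fin τ → ℂ
  | none, k => (if k = txIdx j then 1 else 0) - s.estGain j * s.mix (s.pilotIdx j) k
  | some t, k => s.mix t k

/-- Variances of the estimation error of channel `j` and of the observations. -/
def errVar (j : Fin N ⊕ Fin K) : Option (Fin τ) → ℝ
  | none => ∑ k, ‖s.errMix j none k‖ ^ 2 * s.allVar k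
  | some t => s.obsVar t

theorem errVar_nonneg (j : Fin N ⊕ Fin K) (o : Option (Fin τ)) : 0 ≤ s.errVar j o := by
  rcases o with _ | t
  · exact Finset.sum_nonneg fun k _ => mul_nonneg (by positivity) (s.allVar_nonneg k)
  · exact (s.obsVar_pos t).le

/-- The orthogonality principle: `estGain` is the covariance of channel and observation over the
variance of the observation, exactly what decorrelates the error from its own pilot. On other pilots
both terms vanish. -/
theorem sum_errMix_mul_star_mix (j : Fin N ⊕ Fin K) (t : Fin τ) :
    ∑ k, s.errMix j none k * star (s.mix t k) * s.allVar k = 0 := by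
  have hpos := (s.obsVar_pos (s.pilotIdx j)).ne'
  have h1 : ∀ k, s.errMix j none k * star (s.mix t k) * s.allVar k
      = (if k = txIdx j then star (s.mix t k) * s.allVar k else 0)
        - s.estGain j * (s.mix (s.pilotIdx j) k * star (s.mix t k) * s.allVar k) := by
    intro k
    simp only [errMix]
    split_ifs <;> ring
  simp_rw [h1]
  rw [Finset.sum_sub_distrib, ← Finset.mul_sum, s.sum_mix_mul_star_mix, Finset.sum_ite_eq',
    if_pos (Finset.mem_univ _), s.mix_txIdx, s.allVar_txIdx]
  by_cases h : s.pilotIdx j = t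
  · have : (s.estGain j : ℂ) * s.obsVar (s.pilotIdx j) = s.gain j := by
      rw [← Complex.ofReal_mul, estGain, div_mul_cancel₀ _ hpos]
    simp [h, ← this]
  · simp [h]

theorem sum_errMix_mul_star_errMix (j : Fin N ⊕ Fin K) (o o' : Option (Fin τ)) :
    ∑ k, s.errMix j o k * star (s.errMix j o' k) * s.allVar k
      = if o = o' then (s.errVar j o : ℂ) else 0 := by
  rcases o with _ | t <;> rcases o' with _ | t'
  · rw [if_pos rfl, errVar]
    push_cast
    refine Finset.sum_congr rfl fun k _ => ?_
    rw [← Complex.mul_conj']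
    rfl
  · exact (s.sum_errMix_mul_star_mix j t').trans (if_neg (by simp)).symm
  · have h := congrArg star (s.sum_errMix_mul_star_mix j t)
    rw [star_sum, star_zero] at h
    rw [if_neg (by simp), ← h]
    refine Finset.sum_congr rfl fun k _ => ?_
    simp [errMix, mul_comm]
  · simpa [errMix, errVar] using s.sum_mix_mul_star_mix t t'

variable [MeasurableSpace Ω] {P : Measure Ω} {X : Channels Ω N K B τ}

theorem law_all (hX : X.IsRayleigh s.N0 P) (j : Fin N ⊕ Fin K ⊕ Fin τ) :
    P.map (X.all j) = complexNormalVec B (s.allVar j) := by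
  rcases j with n | i | t
  · exact hX.law_hc n
  · exact hX.law_hd i
  · exact hX.law_Z t

theorem measurable_obs (hX : X.IsRayleigh s.N0 P) (t : Fin τ) : Measurable (s.obs X t) := by
  have := hX.measurable
  have h : s.obs X t = fun ω => ∑ j, s.mix t j • X.all j ω := funext fun ω => s.obs_eq_mixture X t ω
  rw [h]
  fun_prop

/-- The observations along the different pilots are independent circularly symmetric normal
vectors. -/
theorem map_obs [IsProbabilityMeasure P] (hX : X.IsRayleigh s.N0 P) :
    P.map (fun ω t => s.obs X t ω) = Measure.pi fun t => complexNormalVec B (s.obsVar t) := by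
  simp_rw [s.obs_eq_mixture]
  exact map_mixture_eq_pi hX.measurable hX.indep s.allVar_nonneg (s.law_all hX) s.mix
    (fun t => (s.obsVar_pos t).le) s.sum_mix_mul_star_mix

theorem measurable_receivedPilot (hX : X.IsRayleigh s.N0 P) :
    Measurable fun ω => fun (b : Fin B) (t : Fin τ) => s.receivedPilot X ω b t := by
  have := s.measurable_obs hX
  simp_rw [s.receivedPilot_eq_sum_obs]
  refine measurable_pi_lambda _ fun b => measurable_pi_lambda _ fun r =>
    Finset.measurable_sum _ fun t _ => Measurable.mul_const ?_ _
  exact (measurable_pi_apply b).comp ((WithLp.measurable_ofLp 2 _).comp (this t))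

/-- The MMSE estimate of each channel is a multiple of the observation along its pilot. -/
theorem condExp_channel [IsProbabilityMeasure P] (hX : X.IsRayleigh s.N0 P) (j : Fin N ⊕ Fin K) :
    condExp (s.pilotSigma X) P (X.all (txIdx j))
      =ᵐ[P] fun ω => (s.estGain j : ℂ) • s.obs X (s.pilotIdx j) ω := by
  -- `W none` is the estimation error and `W (some t)` the observation on pilot `t`. They are
  -- jointly circular Gaussian and uncorrelated, hence independent.
  set W : Option (Fin τ) → Ω → EuclideanSpace ℂ (Fin B) :=
    fun o ω => ∑ k, s.errMix j o k • X.all k ω with hWdef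
  have hXm := hX.measurable
  have hWm : ∀ o, Measurable (W o) := fun o => by simp only [hWdef]; fun_prop
  have hlaw := map_mixture_eq_pi hX.measurable hX.indep s.allVar_nonneg (s.law_all hX) (s.errMix j)
    (s.errVar_nonneg j) (s.sum_errMix_mul_star_errMix j)
  have hWlaw := map_eval_of_map_eq_pi hWm hlaw none
  have hsome : ∀ t ω, W (some t) ω = s.obs X t ω := fun t ω => (s.obs_eq_mixture X t ω).symm
  have hind : IndepFun (W none) (fun ω => fun (b : Fin B) (t : Fin τ) => s.receivedPilot X ω b t)
      P := by
    have h1 := indepFun_none_some_of_iIndepFun hWm (iIndepFun_of_map_eq_pi hWm hlaw)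
    have h2 := h1.comp (φ := id)
      (ψ := fun y (b : Fin B) (r : Fin τ) => ∑ t, y t b * star (s.pilots r t))
      measurable_id (measurable_pi_lambda _ fun b => measurable_pi_lambda _ fun r => by fun_prop)
    have h3 : (fun ω => fun (b : Fin B) (r : Fin τ) => s.receivedPilot X ω b r)
        = (fun (y : Fin τ → EuclideanSpace ℂ (Fin B)) (b : Fin B) (r : Fin τ) =>
            ∑ t, y t b * star (s.pilots r t)) ∘ fun ω i => W (some i) ω := by
      ext ω b r
      rw [s.receivedPilot_eq_sum_obs]
      simp only [Function.comp_apply, hsome]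
    rw [h3]
    exact h2
  -- The channel is a centred error independent of `Y`, whose conditional mean is zero, plus a
  -- linear function of `Y`, which conditioning leaves unchanged.
  have hsplit : X.all (txIdx j) = W none + fun ω => (s.estGain j : ℂ) • s.obs X (s.pilotIdx j) ω := by
    ext1 ω
    rw [Pi.add_apply, s.obs_eq_mixture]
    simp only [hWdef, errMix, sub_smul, Finset.sum_sub_distrib, Finset.smul_sum, mul_smul]
    simp
  have hle := (s.measurable_receivedPilot hX).comap_le
  have hint : ∀ {V : Ω → EuclideanSpace ℂ (Fin B)} {c : ℝ}, Measurable V → 0 ≤ c →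
      P.map V = complexNormalVec B c → Integrable V P := by
    intro V c hV hc h
    have h1 := (memLp_two_id_complexNormalVec B hc).integrable one_le_two
    rw [← h] at h1
    exact h1.comp_measurable hV
  have hWint : Integrable (W none) P := hint (hWm none) (s.errVar_nonneg j none) hWlaw
  have hYint : Integrable (fun ω => (s.estGain j : ℂ) • s.obs X (s.pilotIdx j) ω) P :=
    (hint (s.measurable_obs hX _) (s.obsVar_pos _).le
      (map_eval_of_map_eq_pi (s.measurable_obs hX) (s.map_obs hX) _)).fun_smul _
  have hzero : ∫ ω, W none ω ∂P = 0 := by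
    rw [← integral_id_complexNormalVec B (s.errVar_nonneg j none), ← hWlaw,
      integral_map (hWm none).aemeasurable (by fun_prop)]
  have hYm : StronglyMeasurable[s.pilotSigma X]
      (fun ω => (s.estGain j : ℂ) • s.obs X (s.pilotIdx j) ω) := by
    have h1 : Measurable fun (Y : Fin B → Fin τ → ℂ) => (s.estGain j : ℂ) •
        (WithLp.toLp 2 fun b => ∑ t', Y b t' * s.pilots t' (s.pilotIdx j) :
          EuclideanSpace ℂ (Fin B)) := by fun_prop
    exact (h1.comp (comap_measurable _)).stronglyMeasurable
  rw [hsplit]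
  refine (condExp_add hWint hYint _).trans ?_
  have h1 : condExp (s.pilotSigma X) P (W none) =ᵐ[P] fun _ => 0 := by
    refine (condExp_indep_eq (hWm none).comap_le hle ?_ hind).trans ?_
    · exact (comap_measurable (W none)).stronglyMeasurable
    · rw [hzero]
  rw [condExp_of_stronglyMeasurable hle hYm hYint]
  filter_upwards [h1] with ω hω
  rw [Pi.add_apply, hω, zero_add]

end System

/-! ### The uplink as an instance of the zero-forcing model -/

namespace System

variable (s : System N K τ)

/-- Received data power of each transmitter, per unit of channel energy. -/
def dataPower : Fin N ⊕ Fin K → ℝ :=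
  Sum.elim (fun n => s.qs n * s.uc n) (fun i => s.ps i * s.ud i)

/-- The transmitters that are cancelled by the filter. -/
def cancelledTx (A : Finset (Fin N)) (G : Finset (Fin τ)) : Finset (Fin N ⊕ Fin K) :=
  A.disjSum (Finset.univ.filter fun i => s.pilotOf i ∈ G)

/-- The uncancelled transmitters that interfere with CU `n`. -/
def interferers (A : Finset (Fin N)) (G : Finset (Fin τ)) (n : Fin N) : Finset (Fin N ⊕ Fin K) :=
  (Aᶜ \ {n}).disjSum (s.uncancelledD G)

theorem dataPower_nonneg (j : Fin N ⊕ Fin K) : 0 ≤ s.dataPower j := by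
  rcases j with n | i
  · exact mul_nonneg (s.qs_nonneg n) (s.uc_nonneg n)
  · exact mul_nonneg (s.ps_nonneg i) (s.ud_nonneg i)

theorem pilotIdx_inl_ne_inr (a : Fin N) (i : Fin K) : s.pilotIdx (.inl a) ≠ s.pilotIdx (.inr i) := by
  intro h
  have h1 := congrArg Fin.val h
  simp only [pilotIdx, Sum.elim_inl, Sum.elim_inr, Fin.val_castLE] at h1
  have := s.pilotOf_ge i
  omega

theorem pilotIdx_inl_injective : Function.Injective fun a : Fin N => s.pilotIdx (.inl a) :=
  Fin.castLE_injective s.tau_gt.le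

theorem obsVar_pilotIdx_inl (n : Fin N) :
    s.obsVar (s.pilotIdx (.inl n)) = s.qp n * s.uc n + s.N0 := by
  have h1 : ∀ m, (if s.pilotIdx (.inl m) = s.pilotIdx (.inl n) then s.gain (.inl m) ^ 2 else 0)
      = if m = n then s.qp n * s.uc n else 0 := by
    intro m
    by_cases h : m = n
    · subst h
      simp [gain, Real.sq_sqrt (mul_nonneg (s.qp_nonneg m) (s.uc_nonneg m))]
    · rw [if_neg h, if_neg]
      simpa [pilotIdx] using h
  have h2 : ∀ i, (if s.pilotIdx (.inr i) = s.pilotIdx (.inl n) then s.gain (.inr i) ^ 2 else 0)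
      = 0 := fun i => if_neg (s.pilotIdx_inl_ne_inr n i).symm
  simp [obsVar, Fintype.sum_sum_type, h1, h2]

theorem obsVar_pilotIdx_inr (k : Fin K) :
    s.obsVar (s.pilotIdx (.inr k)) = ∑ i ∈ s.samePilot k, s.pp i * s.ud i + s.N0 := by
  have h1 : ∀ m, (if s.pilotIdx (.inl m) = s.pilotIdx (.inr k) then s.gain (.inl m) ^ 2 else 0)
      = 0 := fun m => if_neg (s.pilotIdx_inl_ne_inr m k)
  simp only [obsVar, Fintype.sum_sum_type, h1]
  simp [samePilot, Finset.sum_filter, gain, pilotIdx,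
    Real.sq_sqrt (mul_nonneg (s.pp_nonneg _) (s.ud_nonneg _))]

/-- This identifies the variance of a scaled observation in the Gaussian model with the `δ` of the
setting. -/
theorem estGain_sq_mul_obsVar (j : Fin N ⊕ Fin K) :
    s.estGain j ^ 2 * s.obsVar (s.pilotIdx j) = Sum.elim s.deltaC s.deltaD j := by
  have h := (s.obsVar_pos (s.pilotIdx j)).ne'
  have h1 : s.estGain j ^ 2 * s.obsVar (s.pilotIdx j)
      = s.gain j ^ 2 / s.obsVar (s.pilotIdx j) := by
    rw [estGain]
    field_simp
  rw [h1]
  rcases j with n | k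
  · rw [obsVar_pilotIdx_inl, gain, Sum.elim_inl, Sum.elim_inl,
      Real.sq_sqrt (mul_nonneg (s.qp_nonneg n) (s.uc_nonneg n)), deltaC]
  · rw [obsVar_pilotIdx_inr, gain, Sum.elim_inr, Sum.elim_inr,
      Real.sq_sqrt (mul_nonneg (s.pp_nonneg k) (s.ud_nonneg k)), deltaD]

theorem epsC_nonneg (n : Fin N) : 0 ≤ s.epsC n := by
  have h1 := mul_nonneg (s.qp_nonneg n) (s.uc_nonneg n)
  have h2 := s.N0_pos
  rw [epsC, deltaC, sub_nonneg, div_le_one (by positivity)]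
  linarith

theorem epsD_nonneg (k : Fin K) : 0 ≤ s.epsD k := by
  have h1 : s.pp k * s.ud k ≤ ∑ i ∈ s.samePilot k, s.pp i * s.ud i :=
    Finset.single_le_sum (fun i _ => mul_nonneg (s.pp_nonneg i) (s.ud_nonneg i))
      (by simp [samePilot])
  have h0 := mul_nonneg (s.pp_nonneg k) (s.ud_nonneg k)
  have h2 := s.N0_pos
  rw [epsD, deltaD, sub_nonneg, div_le_one (by linarith)]
  linarith

theorem alphaC_pos : 0 < s.alphaC :=
  add_pos_of_nonneg_of_pos
    (add_nonneg
      (Finset.sum_nonneg fun a _ => mul_nonneg (s.dataPower_nonneg (.inl a)) (s.epsC_nonneg a))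
      (Finset.sum_nonneg fun i _ => mul_nonneg (s.dataPower_nonneg (.inr i)) (s.epsD_nonneg i)))
    s.N0_pos

/-- `alphaC` already charges `u ε` to every transmitter. The average interference adds `u δ` for the
uncancelled ones, completing it to `u`. -/
theorem sum_interferers_add_alphaC (A : Finset (Fin N)) (G : Finset (Fin τ)) (n : Fin N) :
    ∑ j ∈ s.interferers A G n,
        s.dataPower j * (s.estGain j ^ 2 * s.obsVar (s.pilotIdx j)) + s.alphaC
      = ∑ a, s.qs a * s.varphiC A a n + s.sigmaC G := by
  have h1 : ∀ a, s.qs a * s.varphiC A a n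
      = (if a ∈ Aᶜ \ {n} then s.qs a * s.uc a * s.deltaC a else 0)
        + s.qs a * s.uc a * s.epsC a := by
    intro a
    rw [varphiC, epsC]
    split_ifs <;> ring
  have h2 : ∀ i, s.ps i * s.varphiD G i
      = (if i ∈ s.uncancelledD G then s.ps i * s.ud i * s.deltaD i else 0)
        + s.ps i * s.ud i * s.epsD i := by
    intro i
    rw [varphiD, epsD]
    split_ifs <;> ring
  simp only [estGain_sq_mul_obsVar, interferers, Finset.sum_disjSum, dataPower, Sum.elim_inl,
    Sum.elim_inr, alphaC, sigmaC, h1, h2, Finset.sum_add_distrib, Finset.sum_ite_mem,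
    Finset.univ_inter]
  ring

variable [MeasurableSpace Ω]

/-- All MMSE channel estimates as a single family. -/
def est (X : Channels Ω N K B τ) (P : Measure Ω) (ω : Ω) (j : Fin N ⊕ Fin K) :
    EuclideanSpace ℂ (Fin B) :=
  Sum.elim (fun n => s.estC X P n ω) (fun i => s.estD X P i ω) j

theorem cancelledSpan_eq (X : Channels Ω N K B τ) (P : Measure Ω) (A : Finset (Fin N))
    (G : Finset (Fin τ)) (ω : Ω) :
    s.cancelledSpan X P A G ω
      = Submodule.span ℂ (s.est X P ω '' (s.cancelledTx A G : Set (Fin N ⊕ Fin K))) := by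
  rw [cancelledSpan]
  congr 1
  ext v
  simp only [cancelledTx, est, Set.mem_union, Set.mem_ofPred_eq, Set.mem_image, Finset.mem_coe,
    Finset.mem_disjSum, Finset.mem_filter, Finset.mem_univ, true_and]
  constructor
  · rintro (⟨a, ha, rfl⟩ | ⟨i, hi, rfl⟩)
    · exact ⟨.inl a, .inl ⟨a, ha, rfl⟩, rfl⟩
    · exact ⟨.inr i, .inr ⟨i, hi, rfl⟩, rfl⟩
  · rintro ⟨_, ⟨a, ha, rfl⟩ | ⟨i, hi, rfl⟩, rfl⟩
    · exact .inl ⟨a, ha, rfl⟩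
    · exact .inr ⟨i, hi, rfl⟩

theorem pzf_eq_zfDir (X : Channels Ω N K B τ) (P : Measure Ω) (A : Finset (Fin N))
    (G : Finset (Fin τ)) (n : Fin N) (ω : Ω) :
    s.pzf X P A G n ω = zfDir (s.est X P ω) (s.cancelledTx A G) (.inl n) := by
  simp only [pzf, zfDir, zfVec, cancelledSpan_eq]
  rfl

theorem sinr_eq_zfSinr (X : Channels Ω N K B τ) (P : Measure Ω) (A : Finset (Fin N))
    (G : Finset (Fin τ)) (n : Fin N) (ω : Ω) :
    s.sinr X P A G n ω = zfSinr s.dataPower s.alphaC (s.est X P ω) (s.cancelledTx A G)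
      (s.interferers A G n) (.inl n) := by
  simp only [sinr, signalPower, interferenceC, interferenceD, pzf_eq_zfDir, zfSinr, interferers,
    Finset.sum_disjSum]
  rfl

/-- Conditional means are determined only almost everywhere; the family being finite, a single null
set serves all estimates. -/
theorem est_ae_eq {P : Measure Ω} [IsProbabilityMeasure P] {X : Channels Ω N K B τ}
    (hX : X.IsRayleigh s.N0 P) :
    ∀ᵐ ω ∂P, s.est X P ω = scaled s.estGain s.pilotIdx (fun t => s.obs X t ω) := by
  have h := ae_all_iff.2 fun j => s.condExp_channel hX j
  filter_upwards [h] with ω hω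
  ext1 j
  rw [scaled, ← hω j]
  rcases j with n | i <;> rfl

theorem card_image_cancelledTx_le (A : Finset (Fin N)) (G : Finset (Fin τ)) :
    ((s.cancelledTx A G).image s.pilotIdx).card ≤ A.card + G.card := by
  have h : (s.cancelledTx A G).image s.pilotIdx
      ⊆ A.image (Fin.castLE s.tau_gt.le) ∪ G := by
    intro t ht
    obtain ⟨j, hj, rfl⟩ := Finset.mem_image.1 ht
    rcases j with a | i
    · exact Finset.mem_union_left _ (Finset.mem_image_of_mem _ (by simpa [cancelledTx] using hj))
    · exact Finset.mem_union_right _ (by simpa [cancelledTx, pilotIdx] using hj)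
  exact (Finset.card_le_card h).trans ((Finset.card_union_le _ _).trans
    (Nat.add_le_add_right Finset.card_image_le _))

theorem pilotIdx_cancelledTx_ne {A : Finset (Fin N)} {G : Finset (Fin τ)} {n : Fin N}
    (hnA : n ∉ A) {j : Fin N ⊕ Fin K} (hj : j ∈ s.cancelledTx A G) :
    s.pilotIdx j ≠ s.pilotIdx (.inl n) := by
  rcases j with a | i
  · intro h
    have : a = n := s.pilotIdx_inl_injective h
    subst this
    exact hnA (by simpa [cancelledTx] using hj)
  · exact (s.pilotIdx_inl_ne_inr n i).symm

/-- D2D pairs are cancelled by whole pilot groups, so an uncancelled pair never shares a pilot with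
a cancelled one; this is what makes its estimate independent of the filter. -/
theorem pilotIdx_interferers_ne {A : Finset (Fin N)} {G : Finset (Fin τ)} {n : Fin N}
    {j : Fin N ⊕ Fin K} (hj : j ∈ s.interferers A G n) :
    s.pilotIdx (.inl n) ≠ s.pilotIdx j ∧ ∀ i ∈ s.cancelledTx A G, s.pilotIdx i ≠ s.pilotIdx j := by
  rcases j with a | k
  · have ha : a ∉ A ∧ a ≠ n := by simpa [interferers] using hj
    refine ⟨fun h => ha.2 (s.pilotIdx_inl_injective h).symm, fun i hi => ?_⟩
    exact s.pilotIdx_cancelledTx_ne ha.1 hi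
  · have hk : s.pilotOf k ∉ G := by simpa [interferers, uncancelledD] using hj
    refine ⟨s.pilotIdx_inl_ne_inr n k, fun i hi => ?_⟩
    rcases i with a | i
    · exact s.pilotIdx_inl_ne_inr a k
    · have hi : s.pilotOf i ∈ G := by simpa [cancelledTx] using hi
      exact fun h => hk (show s.pilotIdx (.inr k) ∈ G from h ▸ hi)

end System

end D2D

end

/-! ### The ergodic rate bound -/

theorem mainTheorem1 {Ω : Type*} [MeasurableSpace Ω] (P : Measure Ω) [IsProbabilityMeasure P]
    {N K B τ : ℕ} (s : D2D.System N K τ) (X : D2D.Channels Ω N K B τ)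
    (hX : X.IsRayleigh s.N0 P)
    (T : ℝ) (hT : (τ : ℝ) ≤ T)
    (bc bd : ℕ) (hb : bc + bd + 1 ≤ B)
    (n : Fin N)
    (A : Finset (Fin N)) (hA : A.card = bc) (hnA : n ∉ A)
    (G : Finset (Fin τ)) (hG : G.card = bd) (hGN : ∀ t ∈ G, N ≤ (t : ℕ)) :
    Integrable (s.rate X P T A G n) P ∧
      (1 - τ / T) * Real.logb 2 (1 + s.sinrLB B bc bd A G n) ≤ ∫ ω, s.rate X P T A G n ω ∂P := by
  have hcard : ((s.cancelledTx A G).image s.pilotIdx).card ≤ bc + bd := by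
    rw [← hA, ← hG]
    exact s.card_image_cancelledTx_le A G
  obtain ⟨hint, hge⟩ := D2D.zfRate_integrable_and_ge (B := B) (a := s.estGain) (n := Sum.inl n)
    s.obsVar_pos (fun j => div_nonneg (s.gain_nonneg j) (s.obsVar_pos _).le) hb hcard
    (fun j hj => s.pilotIdx_cancelledTx_ne hnA hj)
    (fun j hj => s.pilotIdx_interferers_ne (A := A) (G := G) (n := n) hj) s.dataPower_nonneg
    s.alphaC_pos
  have hobs : Measurable fun ω t => s.obs X t ω := measurable_pi_lambda _ (s.measurable_obs hX)
  -- The Gaussian product measure is the law of the observations, so both conclusions pull back to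
  -- `Ω`.
  rw [← s.map_obs hX] at hint hge
  rw [integral_map hobs.aemeasurable hint.1] at hge
  have hae : s.rate X P T A G n =ᵐ[P] fun ω => (1 - τ / T) * Real.logb 2 (1 +
      D2D.zfSinr s.dataPower s.alphaC (D2D.scaled s.estGain s.pilotIdx fun t => s.obs X t ω)
        (s.cancelledTx A G) (s.interferers A G n) (.inl n)) := by
    filter_upwards [s.est_ae_eq hX] with ω hω
    rw [D2D.System.rate, s.sinr_eq_zfSinr, hω]
  refine ⟨((hint.comp_measurable hobs).const_mul _).congr hae.symm, ?_⟩
  rw [integral_congr_ae hae, integral_const_mul]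
  have hτ : (0 : ℝ) < τ := by exact_mod_cast (Nat.zero_le N).trans_lt s.tau_gt
  -- Since `τ ≤ T`, the prefactor is nonnegative and multiplication by it preserves the inequality.
  have hfac : 0 ≤ 1 - τ / T := sub_nonneg.2 ((div_le_one (hτ.trans_le hT)).2 hT)
  refine mul_le_mul_of_nonneg_left (le_of_eq_of_le ?_ hge) hfac
  rw [s.sum_interferers_add_alphaC, s.estGain_sq_mul_obsVar, D2D.System.sinrLB, D2D.System.phiC,
    D2D.System.dataPower, Sum.elim_inl, Sum.elim_inl]
  push_cast
  congr 3
  ring
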